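/- A network is a connected graph $G=(V,E)$ (loops and multiple edges allowed, not necessarily locally finite) with conductances $c(e)\in(0,\infty)$ such that $c(v):=\sum_{e\ni v}c(e)<\infty$ for every vertex $v$ (a loop at $v$ being counted once). Its random walk, when at $u$, chooses an edge $e$ incident to $u$ with probability $c(e)/c(u)$ and moves along it; let $p_n(u,v)$ denote its $n$-step transition probabilities. The bubble norm of the Markov operator $P$ is \[ \|P\|_{\mathrm{bub}} = \sum_{n=0}^\infty (n+1)\,\|P^n\|_{1\to\infty},\qquad \|P^n\|_{1\to\infty}=\sup_{u,v\in V}p_n(u,v). \] $G$ has controlled stationary measure if there is a constant $C>0$ with $C^{-1}\le c(v)\le C$ for every $v\in V$. For a finite set $W \subset V$ let $G^*_W$ be obtained from $G$ by contracting $V\setminus W$ into a single vertex and deleting the resulting self-loops at this vertex, and let $\mathsf{UST}_{G^*_W}$ be the probability measure on the spanning trees $T$ of $G^*_W$ giving $T$ a mass proportional to $\prod_{e\in T}c(e)$. A wired uniform spanning forest $\mathfrak F$ of $G$ is a random set of edges with $\mathbb P(S\subseteq\mathfrak F)=\lim_{m\to\infty}\mathsf{UST}_{G^*_{V_m}}(S\subseteq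 T)$ for every finite $S\subseteq E$, where $V_1\subseteq V_2\subseteq\cdots$ is an increasing sequence of finite sets with union $V$ (the limit exists and does not depend on this sequence). For $v\in V$ and an integer $n\ge 0$ let $\mathfrak B(v,n)$ be the set of vertices at graph distance at most $n$ from $v$ in $\mathfrak F$. **Proposition 5.1.** Let $G$ be a network with controlled stationary measure such that $\|P\|_{\mathrm{bub}}<\infty$, let $\mathfrak F$ be a wired uniform spanning forest of $G$, and let \[ \alpha=\alpha(G)=4\,\frac{\sup_{u\in V}c(u)}{\inf_{u\in V}c(u)}\,\|P\|_{\mathrm{bub}}. \] Then for every $v\in V$ and every integer $n\ge0$, the ball $\mathfrak B(v,n)$ is almost surely finite, \[ \mathbb E\left[|\mathfrak B(v,n)|^k\right]\le e\,k\,k!\,\alpha^k\,(n+1)^{2k}\qquad\text{for every integer } k\ge1, \] and \[ \mathbb E\left[\exp\left(\frac{t}{\alpha(n+1)^2}\,|\mathfrak B(v,n)|\right)\right]\le\frac1{1-t}\qquad\text{for every } 0\le t<1. \] -/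

import Mathlib

open MeasureTheory Filter Topology
open scoped ENNReal NNReal

noncomputable section

/-- A multigraph with vertex set `V` and edge set `E` (loops and multiple edges are allowed, no
finiteness is assumed), in which every edge `e` carries a conductance `c e ∈ (0, ∞)`. The unordered
pair of endpoints of `e` is `ends e`; it is a diagonal pair `s(v, v)` when `e` is a loop. -/
structure WeightedMultigraph (V E : Type*) where
  ends : E → Sym2 V
  c : E → ℝ≥0
  c_pos : ∀ e, 0 < c e

namespace WeightedMultigraph

variable {V E : Type*}

/-- The simple graph on `V` underlying the spanning subgraph of `G` with edge set `ω`. It has the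
same connected components and the same graph distance as that subgraph. -/
def subgraph (G : WeightedMultigraph V E) (ω : Set E) : SimpleGraph V where
  Adj x y := x ≠ y ∧ ∃ e ∈ ω, G.ends e = s(x, y)
  symm := ⟨fun _ _ ⟨hne, e, he, h⟩ => ⟨hne.symm, e, he, h.trans Sym2.eq_swap⟩⟩
  loopless := ⟨fun _ h => h.1 rfl⟩

/-- The vertex conductance `c(v)`: the sum of `c e` over the edges `e` incident to `v`
(a loop at `v` is counted once). -/
def vertexCond (G : WeightedMultigraph V E) (v : V) : ℝ≥0∞ :=
  ∑' e : {e : E // v ∈ G.ends e}, (G.c e : ℝ≥0∞)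

/-- `G` is a network: it is connected and all vertex conductances are finite. -/
structure IsNetwork (G : WeightedMultigraph V E) : Prop where
  connected : (G.subgraph Set.univ).Connected
  vertexCond_ne_top : ∀ v, G.vertexCond v ≠ ∞

/-- There is a positive constant `C` with `C⁻¹ ≤ c(v) ≤ C` for every vertex `v`. -/
def ControlledStationaryMeasure (G : WeightedMultigraph V E) : Prop :=
  ∃ C : ℝ≥0, 0 < C ∧ ∀ v, ((C⁻¹ : ℝ≥0) : ℝ≥0∞) ≤ G.vertexCond v ∧ G.vertexCond v ≤ (C : ℝ≥0∞)

/-- One-step transition probability of the random walk: at `u`, an edge incident to `u` is chosen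
with probability proportional to its conductance, and the walk moves along it. -/
def stepProb (G : WeightedMultigraph V E) (u v : V) : ℝ≥0∞ :=
  (∑' e : {e : E // G.ends e = s(u, v)}, (G.c e : ℝ≥0∞)) / G.vertexCond u

open Classical in
/-- The `n`-step transition probability `p_n(u, v)` of the random walk. -/
def transProb (G : WeightedMultigraph V E) : ℕ → V → V → ℝ≥0∞
  | 0, u, v => if u = v then 1 else 0
  | n + 1, u, v => ∑' w, G.stepProb u w * G.transProb n w v

/-- The bubble norm `∑ₙ (n + 1) ‖Pⁿ‖_{1 → ∞}`, where `‖Pⁿ‖_{1 → ∞} = sup_{u, v} p_n(u, v)`. -/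
def bubbleNorm (G : WeightedMultigraph V E) : ℝ≥0∞ :=
  ∑' n : ℕ, ((n : ℝ≥0∞) + 1) * ⨆ (u : V) (v : V), G.transProb n u v

/-- The constant `α = 4 (sup_u c(u) / inf_u c(u)) · bubbleNorm`. -/
def alpha (G : WeightedMultigraph V E) : ℝ :=
  4 * (((⨆ u, G.vertexCond u) / (⨅ u, G.vertexCond u)) * G.bubbleNorm).toReal

/-- A finite set `T` of edges is (the edge set of) a spanning tree of `G`: it is connected, contains
every vertex, and has no cycle, i.e. no loop (cycle of length one), no two parallel edges (cycle of
length two), and no cycle of length at least three. -/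
def IsSpanningTree (G : WeightedMultigraph V E) (T : Finset E) : Prop :=
  (∀ e ∈ T, ¬ (G.ends e).IsDiag) ∧ Set.InjOn G.ends (T : Set E) ∧
    (G.subgraph (T : Set E)).IsTree

/-- The product of the conductances of the edges in `T`. -/
def weight (G : WeightedMultigraph V E) (T : Finset E) : ℝ≥0∞ :=
  ∏ e ∈ T, (G.c e : ℝ≥0∞)

/-- The uniform spanning tree measure of `G` (used for connected `G` with finite vertex set and
finite vertex conductances): a probability measure on sets of edges, giving each spanning tree a
mass proportional to the product of its conductances. -/
def ust (G : WeightedMultigraph V E) : Measure (Set E) :=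
  (∑' T : {T : Finset E // G.IsSpanningTree T}, G.weight T)⁻¹ •
    Measure.sum fun T : {T : Finset E // G.IsSpanningTree T} =>
      G.weight T • Measure.dirac ((T : Finset E) : Set E)

open Classical in
/-- The contraction map `V → K ∪ {∂}` for a finite set `K` of vertices: vertices in `K` are kept and
all others are sent to the boundary vertex `∂ = none`. -/
def contract (K : Finset V) (v : V) : Option K :=
  if h : v ∈ K then some ⟨v, h⟩ else none

/-- The wired network of a finite set `K` of vertices: all vertices outside `K` are contracted into
a single vertex `∂ = none` and the resulting self-loops at `∂` are deleted. -/
def wired (G : WeightedMultigraph V E) (K : Finset V) :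
    WeightedMultigraph (Option K)
      {e : E // (G.ends e).map (contract K) ≠ s((none : Option K), none)} where
  ends e := (G.ends e).map (contract K)
  c e := G.c e
  c_pos e := G.c_pos e

/-- An exhaustion: an increasing sequence of finite vertex sets whose union is everything. -/
def IsExhaustion (W : ℕ → Finset V) : Prop :=
  Monotone W ∧ ∀ v, ∃ n, v ∈ W n

/-- The random set of edges `F`, defined on the probability space `(Ω, μ)`, is a wired uniform
spanning forest of `G`: for some exhaustion `W`, its law is the weak limit of the uniform spanning
tree measures of the wired networks of `W n`, i.e.
`μ (S ⊆ F) = lim_n UST_{wired (W n)} (S ⊆ T)` for every finite set `S` of edges of `G`.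
(These values determine the law; it is well known that the limit exists for every exhaustion and
does not depend on it.) -/
def IsWUSF (G : WeightedMultigraph V E) {Ω : Type*} [MeasurableSpace Ω] (μ : Measure Ω)
    (F : Ω → Set E) : Prop :=
  Measurable F ∧ ∃ W : ℕ → Finset V, IsExhaustion W ∧
    ∀ S : Finset E, Tendsto
      (fun n => (G.wired (W n)).ust {ω | (S : Set E) ⊆ Subtype.val '' ω}) atTop
      (𝓝 (μ {x | (S : Set E) ⊆ F x}))

/-- The intrinsic ball of radius `n` around `v` in the subgraph with edge set `ω`: all vertices whose
graph distance to `v` in that subgraph is at most `n` (the distance between different components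
is infinite). -/
def intrinsicBall (G : WeightedMultigraph V E) (ω : Set E) (v : V) (n : ℕ) : Set V :=
  {u | (G.subgraph ω).edist v u ≤ n}

end WeightedMultigraph

end

/-! On a finite wired network, root every spanning tree at the boundary vertex, so that a tree is a
parent map without cycles. By the matrix-tree theorem, the trees extending a given subtree on `A`
have total weight proportional to `det (1 - Q_A)`, where `Q_A` is the walk stopped on `A`, and
adjoining a vertex `x` to `A` multiplies this determinant by the Green function `G_A(x, x)`. The
probability that a given path hangs off the subtree is therefore a product of transition
probabilities and Green functions. By reversibility this is, up to a ratio of vertex conductances,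
the mass of the walks whose loop-erasure is that path.

The heart is `loopErasedSum_potential_le`: loop-erased paths with fewer than `n` steps have total
mass at most `β n`, where `β` is the bubble norm. The constant 1 is a potential of the walk stopped
on `B` (certain exit). Split a potential at the first visit to the starting point `x`: the part that
avoids `x` is handled by induction, and the part that returns to `x` costs at most `(G_B G_B)(x, x)
= ∑ (n + 1) Q_B^n(x, x) ≤ β`. Consequently, given any subtree, each of its vertices has on average
at most `(M / m) β (n + 1)` descendants within `n` generations and off the subtree
(`treeSum_descCount_le`); here `m` and `M` bound the vertex conductances.

Moments follow by induction (`sum_card_treeBall_pow_le`). Given `k` points in the ball around `v`,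
reveal the subtree spanned by the root, `v` and these points. Every vertex of the ball descends
within `n` generations from one of at most `(k + 1)(n + 1)` revealed vertices, so passing from the
`k`-th to the next moment costs a factor `(k + 1) a` with `a = (M / m) β (n + 1)²`. Thus the `k`-th
moment is at most `k! a^k`, as for an exponential variable of mean `a`. Since `a = α (n + 1)² / 4`,
both bounds of the theorem hold with room to spare.

To reach the forest, restrict the ball to a finite set of edges: its moments are then determined by
finitely many cylinder events and pass to the limit. Monotone convergence removes the restriction,
and the finite first moment gives almost sure finiteness. -/

noncomputable section

/-! ### Green functions of substochastic matrices and loop-erased sums -/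

namespace LoopErased

variable {W : Type*} [Fintype W] [DecidableEq W]

/-- The matrix `Q` with the rows indexed by `B` replaced by zero: the walk is stopped on `B`. -/
def killRows (Q : Matrix W W ℝ) (B : Finset W) : Matrix W W ℝ :=
  fun x y => if x ∈ B then 0 else Q x y

/-- The Green function of the walk stopped on `B`. -/
def green (Q : Matrix W W ℝ) (B : Finset W) : Matrix W W ℝ :=
  fun x y => ∑' n : ℕ, (killRows Q B ^ n) x y

/-- A nonnegative matrix the powers of which are summable with linear weights, with sums at most
`β` on the diagonal. -/
structure HasBubble (Q : Matrix W W ℝ) (β : ℝ) : Prop where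
  nonneg : ∀ x y, 0 ≤ Q x y
  summable : ∀ x y, Summable fun n : ℕ => ((n : ℝ) + 1) * (Q ^ n) x y
  le : ∀ x, ∑' n : ℕ, ((n : ℝ) + 1) * (Q ^ n) x x ≤ β

section

variable {Q : Matrix W W ℝ} {β : ℝ}

lemma pow_apply_nonneg {K : Matrix W W ℝ} (hK : ∀ x y, 0 ≤ K x y) (n : ℕ) (x y : W) :
    0 ≤ (K ^ n) x y := by
  induction n generalizing x y with
  | zero => simp only [pow_zero, Matrix.one_apply]; split_ifs <;> norm_num
  | succ n ih =>
    rw [pow_succ, Matrix.mul_apply]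
    exact Finset.sum_nonneg fun k _ => mul_nonneg (ih x k) (hK k y)

lemma pow_apply_le_pow_apply {K L : Matrix W W ℝ} (hK : ∀ x y, 0 ≤ K x y)
    (h : ∀ x y, K x y ≤ L x y) (n : ℕ) (x y : W) : (K ^ n) x y ≤ (L ^ n) x y := by
  induction n generalizing x y with
  | zero => simp
  | succ n ih =>
    rw [pow_succ, pow_succ, Matrix.mul_apply, Matrix.mul_apply]
    exact Finset.sum_le_sum fun k _ => mul_le_mul (ih x k) (h k y) (hK k y)
      (pow_apply_nonneg (fun a b => (hK a b).trans (h a b)) n x k)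

lemma sum_ite_mem_zero (B : Finset W) (f : W → ℝ) :
    ∑ y, (if y ∈ B then 0 else f y) = ∑ y ∈ Bᶜ, f y := by
  rw [← Finset.sum_subset (Finset.subset_univ Bᶜ)]
  · exact Finset.sum_congr rfl fun y hy => if_neg (Finset.mem_compl.1 hy)
  · exact fun y _ hy => if_pos (not_not.1 fun h => hy (Finset.mem_compl.2 h))

lemma killRows_nonneg (hQ : HasBubble Q β) (B : Finset W) (x y : W) : 0 ≤ killRows Q B x y := by
  unfold killRows; split_ifs; exacts [le_rfl, hQ.nonneg x y]

lemma killRows_le (hQ : HasBubble Q β) (B : Finset W) (x y : W) : killRows Q B x y ≤ Q x y := by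
  unfold killRows; split_ifs; exacts [hQ.nonneg x y, le_rfl]

/-- Stopping the walk on `B` preserves the bubble bound. -/
lemma HasBubble.killRows (hQ : HasBubble Q β) (B : Finset W) : HasBubble (killRows Q B) β := by
  have hle : ∀ (x y : W) (n : ℕ), ((n : ℝ) + 1) * (LoopErased.killRows Q B ^ n) x y
      ≤ ((n : ℝ) + 1) * (Q ^ n) x y := fun x y n =>
    mul_le_mul_of_nonneg_left
      (pow_apply_le_pow_apply (killRows_nonneg hQ B) (killRows_le hQ B) n x y) (by positivity)
  have hs : ∀ x y, Summable fun n : ℕ => ((n : ℝ) + 1) * (LoopErased.killRows Q B ^ n) x y :=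
    fun x y => Summable.of_nonneg_of_le (fun n => mul_nonneg (by positivity)
      (pow_apply_nonneg (killRows_nonneg hQ B) n x y)) (hle x y) (hQ.summable x y)
  exact ⟨killRows_nonneg hQ B, hs,
    fun x => ((hs x x).tsum_le_tsum (hle x x) (hQ.summable x x)).trans (hQ.le x)⟩

lemma HasBubble.summable_pow (hQ : HasBubble Q β) (x y : W) : Summable fun n : ℕ => (Q ^ n) x y :=
  Summable.of_nonneg_of_le (fun n => pow_apply_nonneg hQ.nonneg n x y)
    (fun n => le_mul_of_one_le_left (pow_apply_nonneg hQ.nonneg n x y)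
      (by linarith [(Nat.cast_nonneg n : (0 : ℝ) ≤ n)])) (hQ.summable x y)

lemma green_nonneg (hQ : HasBubble Q β) (B : Finset W) (x y : W) : 0 ≤ green Q B x y :=
  tsum_nonneg fun n => pow_apply_nonneg (killRows_nonneg hQ B) n x y

lemma one_sub_mul_green (hQ : HasBubble Q β) (B : Finset W) :
    (1 - killRows Q B) * green Q B = 1 := by
  have hs := (hQ.killRows B).summable_pow
  rw [sub_mul, one_mul, sub_eq_iff_eq_add]
  ext x y
  rw [Matrix.add_apply, Matrix.mul_apply]
  simp only [green]
  rw [(hs x y).tsum_eq_zero_add, pow_zero]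
  congr 1
  simp_rw [pow_succ', Matrix.mul_apply, ← tsum_mul_left]
  rw [Summable.tsum_finsetSum fun k _ => (hs k y).mul_left _]

lemma green_mul_one_sub (hQ : HasBubble Q β) (B : Finset W) :
    green Q B * (1 - killRows Q B) = 1 :=
  mul_eq_one_comm.1 (one_sub_mul_green hQ B)

/-- This is `(1 - K)⁻² = ∑ (n + 1) Kⁿ`, the origin of the weights `n + 1` in the bubble norm. -/
lemma green_mul_green (hQ : HasBubble Q β) (B : Finset W) (x y : W) :
    (green Q B * green Q B) x y = ∑' n : ℕ, ((n : ℝ) + 1) * (killRows Q B ^ n) x y := by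
  set K := killRows Q B with hK
  have hB := hQ.killRows B
  set L : Matrix W W ℝ := fun x y => ∑' n : ℕ, ((n : ℝ) + 1) * (K ^ n) x y with hL
  have key : (1 - K) * L = green Q B := by
    rw [sub_mul, one_mul, sub_eq_iff_eq_add]
    ext x y
    rw [Matrix.add_apply, Matrix.mul_apply]
    simp only [hL, green, ← tsum_mul_left]
    rw [← Summable.tsum_finsetSum fun k _ => (hB.summable k y).mul_left _]
    have h2 : ∀ n : ℕ, ∑ k, K x k * (((n : ℝ) + 1) * (K ^ n) k y)
        = ((n : ℝ) + 1) * (K ^ (n + 1)) x y := by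
      intro n
      rw [pow_succ', Matrix.mul_apply, Finset.mul_sum]
      exact Finset.sum_congr rfl fun k _ => by ring
    rw [tsum_congr h2]
    have h3 : Summable fun n : ℕ => (n : ℝ) * (K ^ n) x y := by
      have := (hB.summable x y).sub (hB.summable_pow x y)
      refine this.congr fun n => by ring
    have h4 : ∑' n : ℕ, ((n : ℝ) + 1) * (K ^ (n + 1)) x y = ∑' n : ℕ, (n : ℝ) * (K ^ n) x y := by
      rw [h3.tsum_eq_zero_add]; simp
    rw [h4, ← (hB.summable_pow x y).tsum_add h3]
    exact tsum_congr fun n => by ring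
  have : green Q B * green Q B = L := by
    nth_rewrite 2 [← key]
    rw [← Matrix.mul_assoc, green_mul_one_sub hQ, Matrix.one_mul]
  rw [this]

lemma green_mul_green_le (hQ : HasBubble Q β) (B : Finset W) (x : W) :
    (green Q B * green Q B) x x ≤ β := by
  rw [green_mul_green hQ]; exact (hQ.killRows B).le x

lemma green_eq (hQ : HasBubble Q β) (B : Finset W) (x y : W) :
    green Q B x y = (if x = y then 1 else 0) + ∑ k, killRows Q B x k * green Q B k y := by
  have := congrFun (congrFun (one_sub_mul_green hQ B) x) y
  rw [sub_mul, one_mul, Matrix.sub_apply, Matrix.mul_apply, Matrix.one_apply] at this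
  linarith

/-- The stopped walk stays visible at its stopping point for one unit of time. Hence for a target in
`B` the Green function is a hitting probability. -/
lemma green_of_mem (hQ : HasBubble Q β) {B : Finset W} {x : W} (hx : x ∈ B) (y : W) :
    green Q B x y = if x = y then 1 else 0 := by
  rw [green_eq hQ]; simp [killRows, hx]

lemma one_le_green (hQ : HasBubble Q β) (B : Finset W) (x : W) : 1 ≤ green Q B x x := by
  rw [green_eq hQ, if_pos rfl]
  linarith [Finset.sum_nonneg fun k (_ : k ∈ Finset.univ) =>
    mul_nonneg (killRows_nonneg hQ B x k) (green_nonneg hQ B k x)]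

omit [Fintype W] in
lemma killRows_sub_killRows_insert (Q : Matrix W W ℝ) {B : Finset W} {x : W} (hx : x ∉ B)
    (y z : W) : (killRows Q B - killRows Q (insert x B)) y z = if y = x then Q x z else 0 := by
  rw [Matrix.sub_apply]
  unfold killRows
  by_cases hy : y = x
  · subst hy; simp [hx]
  · simp [hy]

/-- First passage decomposition at `x`. -/
lemma green_eq_first_passage (hQ : HasBubble Q β) {B : Finset W} {x : W} (hx : x ∉ B) (y z : W) :
    green Q B y z = green Q (insert x B) y z
      + green Q (insert x B) y x * (green Q B x z - if x = z then 1 else 0) := by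
  -- Resolvent identity `G - G' = G' (K - K') G`; only row `x` of `K - K'` is nonzero. The last exit
  -- decomposition uses the other order, `G (K - K') G'`.
  have h : green Q B - green Q (insert x B) = green Q (insert x B) *
      ((killRows Q B - killRows Q (insert x B)) * green Q B) := by
    have h1 := one_sub_mul_green hQ B
    have h2 := green_mul_one_sub hQ (insert x B)
    have : killRows Q B - killRows Q (insert x B)
      = (1 - killRows Q (insert x B)) - (1 - killRows Q B) := by abel
    rw [this, sub_mul, mul_sub, h1, ← Matrix.mul_assoc, h2, Matrix.one_mul, Matrix.mul_one]
  have h' := congrFun (congrFun h y) z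
  rw [Matrix.sub_apply, Matrix.mul_apply] at h'
  simp only [Matrix.mul_apply, killRows_sub_killRows_insert Q hx, ite_mul, zero_mul] at h'
  rw [Finset.sum_eq_single x (fun b _ hb => by simp [hb]) (by simp)] at h'
  simp only [if_true] at h'
  have h3 := green_eq hQ B x z
  simp only [killRows, hx, if_false] at h3
  rw [← sub_eq_iff_eq_add'] at h3
  rw [h3]
  linarith

/-- Last exit decomposition at `x`. -/
lemma green_eq_last_exit (hQ : HasBubble Q β) {B : Finset W} {x : W} (hx : x ∉ B) (z : W) :
    green Q B x z = (if x = z then 1 else 0)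
      + green Q B x x * ∑ k, Q x k * green Q (insert x B) k z := by
  have h : green Q B - green Q (insert x B) = green Q B *
      ((killRows Q B - killRows Q (insert x B)) * green Q (insert x B)) := by
    have h1 := one_sub_mul_green hQ (insert x B)
    have h2 := green_mul_one_sub hQ B
    have : killRows Q B - killRows Q (insert x B)
      = (1 - killRows Q (insert x B)) - (1 - killRows Q B) := by abel
    rw [this, sub_mul, mul_sub, h1, ← Matrix.mul_assoc, h2, Matrix.one_mul, Matrix.mul_one]
  have h' := congrFun (congrFun h x) z
  rw [Matrix.sub_apply, Matrix.mul_apply, green_of_mem hQ (Finset.mem_insert_self x B)] at h'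
  simp only [Matrix.mul_apply, killRows_sub_killRows_insert Q hx, ite_mul, zero_mul] at h'
  rw [Finset.sum_eq_single x (fun b _ hb => by simp [hb]) (by simp)] at h'
  simp only [if_true] at h'
  linarith

lemma green_eq_green_insert_mul (hQ : HasBubble Q β) {B : Finset W} {x : W} (hx : x ∉ B) (y : W) :
    green Q B y x = green Q (insert x B) y x * green Q B x x := by
  have := green_eq_first_passage hQ hx y x
  rw [if_pos rfl] at this
  linarith

/-- Last exit decomposition at `x`, for sums over targets off `B`. -/
lemma sum_green_mul (hQ : HasBubble Q β) {B : Finset W} {x : W} (hx : x ∉ B) (κ : W → ℝ) :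
    ∑ z ∈ Bᶜ, green Q B x z * κ z = green Q B x x * (κ x +
      ∑ y ∈ (insert x B)ᶜ, Q x y * ∑ z ∈ (insert x B)ᶜ, green Q (insert x B) y z * κ z) := by
  have hBc : Bᶜ = insert x (insert x B)ᶜ := by
    ext z; by_cases hz : z = x <;> simp [hz, hx]
  rw [hBc, Finset.sum_insert (by simp), mul_add]
  congr 1
  have h1 : ∀ z ∈ (insert x B)ᶜ, green Q B x z * κ z
      = green Q B x x * ∑ y ∈ (insert x B)ᶜ, Q x y * (green Q (insert x B) y z * κ z) := by
    intro z hz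
    have hzx : x ≠ z := by rintro rfl; simp at hz
    rw [green_eq_last_exit hQ hx z, if_neg hzx, zero_add, mul_assoc, Finset.sum_mul]
    congr 1
    rw [← Finset.sum_subset (Finset.subset_univ (insert x B)ᶜ)]
    · exact Finset.sum_congr rfl fun _ _ => by ring
    · intro y _ hy
      have hy' : y ∈ insert x B := not_not.1 fun h => hy (Finset.mem_compl.2 h)
      rw [green_of_mem hQ hy', if_neg]
      · ring
      · rintro rfl; exact (Finset.mem_compl.1 hz) hy'
  rw [Finset.sum_congr rfl h1, ← Finset.mul_sum, Finset.sum_comm]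
  simp_rw [Finset.mul_sum]

end

/-- The sum, over the simple paths off `B` that start at `x` and have fewer than `n` steps, of the
total mass of the walks off `B` with loop-erasure equal to the path, weighted by the value of `h` at
the endpoint. -/
def loopErasedSum (Q : Matrix W W ℝ) (h : W → ℝ) : ℕ → Finset W → W → ℝ
  | 0, _, _ => 0
  | n + 1, B, x => green Q B x x *
      (h x + ∑ y ∈ (insert x B)ᶜ, Q x y * loopErasedSum Q h n (insert x B) y)

/-! ### Linear growth of loop-erased sums -/

variable {Q : Matrix W W ℝ} {β : ℝ}

lemma loopErasedSum_add (h k : W → ℝ) (n : ℕ) (B : Finset W) (x : W) :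
    loopErasedSum Q (fun z => h z + k z) n B x
      = loopErasedSum Q h n B x + loopErasedSum Q k n B x := by
  induction n generalizing B x with
  | zero => simp [loopErasedSum]
  | succ n ih =>
    simp only [loopErasedSum, ih, mul_add, Finset.sum_add_distrib]
    ring

lemma loopErasedSum_mul (h : W → ℝ) (a : ℝ) (n : ℕ) (B : Finset W) (x : W) :
    loopErasedSum Q (fun z => h z * a) n B x = loopErasedSum Q h n B x * a := by
  induction n generalizing B x with
  | zero => simp [loopErasedSum]
  | succ n ih =>
    simp only [loopErasedSum, ih, ← mul_assoc, ← Finset.sum_mul]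
    ring

lemma loopErasedSum_mono (hQ : HasBubble Q β) {h k : W → ℝ} {B : Finset W}
    (hk : ∀ z ∉ B, h z ≤ k z) (n : ℕ) {x : W} (hx : x ∉ B) :
    loopErasedSum Q h n B x ≤ loopErasedSum Q k n B x := by
  induction n generalizing B x with
  | zero => simp [loopErasedSum]
  | succ n ih =>
    simp only [loopErasedSum]
    refine mul_le_mul_of_nonneg_left (add_le_add (hk x hx) (Finset.sum_le_sum fun y hy => ?_))
      (green_nonneg hQ B x x)
    exact mul_le_mul_of_nonneg_left (ih (fun z hz => hk z (by simp at hz; exact hz.2))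
      (by simpa using hy)) (hQ.nonneg x y)

lemma loopErasedSum_congr {h k : W → ℝ} {B : Finset W}
    (hk : ∀ z ∉ B, h z = k z) (n : ℕ) {x : W} (hx : x ∉ B) :
    loopErasedSum Q h n B x = loopErasedSum Q k n B x := by
  induction n generalizing B x with
  | zero => simp [loopErasedSum]
  | succ n ih =>
    simp only [loopErasedSum]
    rw [hk x hx, Finset.sum_congr rfl fun y hy => ?_]
    rw [ih (fun z hz => hk z (by simp at hz; exact hz.2)) (by simpa using hy)]

/-- The full Green sum satisfies the recursion of `loopErasedSum` exactly, by last exit from `x`;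
truncating the number of steps only discards nonnegative terms. -/
lemma loopErasedSum_le_green (hQ : HasBubble Q β) {h : W → ℝ} (hh : ∀ z, 0 ≤ h z) (n : ℕ)
    {B : Finset W} {x : W} (hx : x ∉ B) :
    loopErasedSum Q h n B x ≤ ∑ z ∈ Bᶜ, green Q B x z * h z := by
  induction n generalizing B x with
  | zero => exact Finset.sum_nonneg fun z _ => mul_nonneg (green_nonneg hQ B x z) (hh z)
  | succ n ih =>
    rw [sum_green_mul hQ hx]
    simp only [loopErasedSum]
    refine mul_le_mul_of_nonneg_left (add_le_add_right (Finset.sum_le_sum fun y hy => ?_) _)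
      (green_nonneg hQ B x x)
    exact mul_le_mul_of_nonneg_left (ih (Finset.mem_compl.1 hy)) (hQ.nonneg x y)

/-- The loop-erased sum of a potential grows at most linearly in the number of steps. -/
lemma loopErasedSum_potential_le (hQ : HasBubble Q β) {κ : W → ℝ} (hκ : ∀ z, 0 ≤ κ z) (n : ℕ)
    {B : Finset W} {x : W} (hx : x ∉ B) :
    loopErasedSum Q (fun y => ∑ z ∈ Bᶜ, green Q B y z * κ z) n B x
      ≤ β * n * ∑ z ∈ Bᶜ, green Q B x z * κ z := by
  induction n generalizing B x with
  | zero => simp [loopErasedSum]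
  | succ n ih =>
    set h : W → ℝ := fun y => ∑ z ∈ Bᶜ, green Q B y z * κ z with hh
    set B' := insert x B with hB'
    set h' : W → ℝ := fun y => ∑ z ∈ B'ᶜ, green Q B' y z * κ z with hh'
    have hh0 : 0 ≤ h x := Finset.sum_nonneg fun z _ => mul_nonneg (green_nonneg hQ B x z) (hκ z)
    have hBc : Bᶜ = insert x B'ᶜ := by
      ext z; by_cases hz : z = x <;> simp [hz, hx, hB']
    -- From `y`, the walk either accumulates `κ` without meeting `x`, or it hits `x` and starts
    -- afresh there.
    have hdec : ∀ y, h y = h' y + green Q B' y x * h x := by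
      intro y
      simp only [hh, hh', hBc]
      rw [Finset.sum_insert (by simp [hB']), Finset.sum_insert (by simp [hB']),
        green_eq_green_insert_mul hQ hx y, mul_add, Finset.mul_sum]
      have : ∀ z ∈ B'ᶜ, green Q B y z * κ z
          = green Q B' y z * κ z + green Q B' y x * (green Q B x z * κ z) := by
        intro z hz
        have hzx : x ≠ z := by rintro rfl; simp [hB'] at hz
        rw [green_eq_first_passage hQ hx y z, if_neg hzx]; ring
      rw [Finset.sum_congr rfl this, Finset.sum_add_distrib]
      ring
    have hsplit : ∀ y, loopErasedSum Q h n B' y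
        = loopErasedSum Q h' n B' y + loopErasedSum Q (fun z => green Q B' z x) n B' y * h x := by
      intro y
      rw [← loopErasedSum_mul, ← loopErasedSum_add]
      congr 1
      funext z
      exact hdec z
    -- Induction applies to `h'`, the potential adapted to `B'`. For the part through `x` the limit
    -- on the number of steps is dropped altogether.
    have h1 : ∑ y ∈ B'ᶜ, Q x y * loopErasedSum Q h n B' y
        ≤ β * n * ∑ y ∈ B'ᶜ, Q x y * h' y
          + (∑ y ∈ B'ᶜ, Q x y * ∑ z ∈ B'ᶜ, green Q B' y z * green Q B' z x) * h x := by
      rw [Finset.mul_sum, Finset.sum_mul, ← Finset.sum_add_distrib]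
      refine Finset.sum_le_sum fun y hy => ?_
      have hy' : y ∉ B' := by simpa using hy
      rw [hsplit, mul_add]
      refine add_le_add ?_ ?_
      · have := mul_le_mul_of_nonneg_left (ih hy') (hQ.nonneg x y)
        simp only [hh'] at this ⊢
        linarith
      · rw [← mul_assoc]
        exact mul_le_mul_of_nonneg_right (mul_le_mul_of_nonneg_left
          (loopErasedSum_le_green hQ (fun z => green_nonneg hQ B' z x) n hy') (hQ.nonneg x y)) hh0
    have h2 : h x = green Q B x x * (κ x + ∑ y ∈ B'ᶜ, Q x y * h' y) := sum_green_mul hQ hx κ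
    -- Since `G_{B'}(x, x) = 1`, the term `h x` of the recursion is the summand `z = x` of the
    -- bubble and costs nothing extra.
    have h3 := sum_green_mul hQ hx (fun z => green Q B' z x)
    rw [← hB', green_of_mem hQ (Finset.mem_insert_self x B), if_pos rfl] at h3
    -- `G_{B'}(z, x) ≤ G_B(z, x)`, so the sum is at most `(G_B G_B)(x, x)`.
    have h4 : ∑ z ∈ Bᶜ, green Q B x z * green Q B' z x ≤ β := by
      refine le_trans ?_ (green_mul_green_le hQ B x)
      rw [Matrix.mul_apply]
      refine le_trans (Finset.sum_le_sum fun z _ => mul_le_mul_of_nonneg_left ?_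
        (green_nonneg hQ B x z)) (Finset.sum_le_univ_sum_of_nonneg fun z =>
          mul_nonneg (green_nonneg hQ B x z) (green_nonneg hQ B z x))
      rw [green_eq_green_insert_mul hQ hx z]
      exact le_mul_of_one_le_right (green_nonneg hQ _ z x) (one_le_green hQ B x)
    have hβ : 0 ≤ β := le_trans (Finset.sum_nonneg fun z _ =>
      mul_nonneg (green_nonneg hQ B x z) (green_nonneg hQ B' z x)) h4
    have hg := green_nonneg hQ B x x
    simp only [loopErasedSum]
    rw [← hB']
    calc green Q B x x * (h x + ∑ y ∈ B'ᶜ, Q x y * loopErasedSum Q h n B' y)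
        ≤ green Q B x x * (h x + (β * n * ∑ y ∈ B'ᶜ, Q x y * h' y
          + (∑ y ∈ B'ᶜ, Q x y * ∑ z ∈ B'ᶜ, green Q B' y z * green Q B' z x) * h x)) :=
          mul_le_mul_of_nonneg_left (add_le_add_right h1 _) hg
      _ = (∑ z ∈ Bᶜ, green Q B x z * green Q B' z x) * h x
          + β * n * (green Q B x x * ∑ y ∈ B'ᶜ, Q x y * h' y) := by rw [h3]; ring
      _ ≤ β * h x + β * n * h x := by
          refine add_le_add (mul_le_mul_of_nonneg_right h4 hh0)
            (mul_le_mul_of_nonneg_left ?_ (by positivity))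
          rw [h2]
          exact mul_le_mul_of_nonneg_left (le_add_of_nonneg_left (hκ x)) hg
      _ = β * (n + 1 : ℕ) * h x := by push_cast; ring

/-- With `κ` the probability of leaving the complement of `B` in one step (into `B` or by being
killed), the constant 1 is the potential of `κ`: the walk exits surely. -/
lemma loopErasedSum_one_le (hQ : HasBubble Q β) (hrow : ∀ x, ∑ y, Q x y ≤ 1) (n : ℕ)
    {B : Finset W} {x : W} (hx : x ∉ B) :
    loopErasedSum Q (fun _ => 1) n B x ≤ β * n := by
  set κ : W → ℝ := fun z => 1 - ∑ y ∈ Bᶜ, Q z y with hκ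
  have hκ0 : ∀ z, 0 ≤ κ z := fun z => by
    have := (Finset.sum_le_univ_sum_of_nonneg (s := Bᶜ) (f := fun y => Q z y)
      fun y => hQ.nonneg z y).trans (hrow z)
    simp only [hκ]; linarith
  have hone : ∀ y ∉ B, ∑ z ∈ Bᶜ, green Q B y z * κ z = 1 := by
    intro y hy
    set v : W → ℝ := fun z => if z ∈ B then 0 else 1 with hv
    set k : W → ℝ := fun z => if z ∈ B then 0 else κ z with hk
    -- Certain exit is obtained algebraically: `(1 - K) v = k` is the definition of `κ`, and `1 - K`
    -- is inverted by `green`.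
    have h1 : (1 - killRows Q B).mulVec v = k := by
      funext z
      rw [Matrix.sub_mulVec, Matrix.one_mulVec, Pi.sub_apply, Matrix.mulVec, dotProduct]
      by_cases hz : z ∈ B
      · simp [hv, hk, killRows, hz]
      · simp only [hv, hk, killRows, hz, if_false, hκ, mul_ite, mul_one, mul_zero]
        rw [sum_ite_mem_zero]
    have h2 : (green Q B).mulVec k = v := by
      rw [← h1, Matrix.mulVec_mulVec, green_mul_one_sub hQ, Matrix.one_mulVec]
    have h3 := congrFun h2 y
    simp only [Matrix.mulVec, dotProduct, hv, hk, hy, if_false, mul_ite, mul_zero] at h3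
    rw [← h3, sum_ite_mem_zero]
  have := loopErasedSum_potential_le hQ hκ0 n hx
  rw [hone x hx, mul_one] at this
  rwa [loopErasedSum_congr (k := fun _ => 1) hone n hx] at this

/-- The loop-erased sum of a function bounded by `M` grows at most linearly. -/
lemma loopErasedSum_le (hQ : HasBubble Q β) (hrow : ∀ x, ∑ y, Q x y ≤ 1) {h : W → ℝ} {M : ℝ}
    (h0 : 0 ≤ M) (hM : ∀ x, h x ≤ M) (n : ℕ) {B : Finset W} {x : W} (hx : x ∉ B) :
    loopErasedSum Q h n B x ≤ β * n * M := by
  refine (loopErasedSum_mono hQ (k := fun _ => 1 * M) (fun z _ => by simpa using hM z) n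
    hx).trans ?_
  rw [loopErasedSum_mul]
  exact mul_le_mul_of_nonneg_right (loopErasedSum_one_le hQ hrow n hx) h0

end LoopErased

/-! ### Parent maps of rooted trees and the matrix-tree theorem -/

namespace ParentMap

variable {W : Type*}

/-- One step towards the root `none` along the parent map `f`. -/
def step (f : W → Option W) (o : Option W) : Option W := o.bind f

/-- The parent map `f` describes a tree rooted at `none`. -/
def IsAcyclic (f : W → Option W) : Prop := ∀ x, ∃ k, (step f)^[k] (some x) = none

@[simp] lemma step_some (f : W → Option W) (x : W) : step f (some x) = f x := rfl

lemma iterate_step_none (f : W → Option W) (k : ℕ) : (step f)^[k] none = none :=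
  Function.iterate_fixed rfl k

lemma iterate_step_none_of_le {f : W → Option W} {o : Option W} {k l : ℕ} (h : k ≤ l)
    (hk : (step f)^[k] o = none) : (step f)^[l] o = none := by
  obtain ⟨m, rfl⟩ := Nat.exists_eq_add_of_le' h
  rw [Function.iterate_add_apply, hk, iterate_step_none]

/-- The number of steps to the root. -/
def depth (f : W → Option W) (x : W) : ℕ := sInf {k | (step f)^[k] (some x) = none}

lemma depth_lt {f : W → Option W} (hf : IsAcyclic f) {x y : W} (h : f x = some y) :
    depth f y < depth f x := by
  have hx : (step f)^[depth f x] (some x) = none := Nat.sInf_mem (hf x)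
  cases hd : depth f x with
  | zero => rw [hd] at hx; simp at hx
  | succ k =>
    rw [hd, Function.iterate_succ_apply, step_some, h] at hx
    exact Nat.lt_succ_of_le (Nat.sInf_le hx)

/-- A vertex met twice would be periodic and could never reach the root. -/
lemma iterate_step_injective {f : W → Option W} (hf : IsAcyclic f) {x w : W} {i j : ℕ}
    (hi : (step f)^[i] (some x) = some w) (hj : (step f)^[j] (some x) = some w) : i = j := by
  wlog hij : i ≤ j generalizing i j
  · exact (this hj hi (le_of_not_ge hij)).symm
  obtain ⟨m, rfl⟩ := Nat.exists_eq_add_of_le' hij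
  rw [Function.iterate_add_apply, hi] at hj
  rcases Nat.eq_zero_or_pos m with rfl | hm
  · simp
  obtain ⟨k, hk⟩ := hf w
  have h1 : ∀ r, (step f)^[m * r] (some w) = some w := fun r => by
    rw [Function.iterate_mul]; exact Function.iterate_fixed hj r
  have := iterate_step_none_of_le (Nat.le_mul_of_pos_left k hm) hk
  rw [h1] at this
  simp at this

lemma iterate_step_eq_of_agree {f g : W → Option W} {A : Finset W}
    (hcl : ∀ x ∈ A, ∀ y, g x = some y → y ∈ A) (hfg : ∀ x ∈ A, f x = g x) (k : ℕ) {x : W}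
    (hx : x ∈ A) : (step f)^[k] (some x) = (step g)^[k] (some x) := by
  induction k generalizing x with
  | zero => rfl
  | succ k ih =>
    rw [Function.iterate_succ_apply, Function.iterate_succ_apply, step_some, step_some, hfg x hx]
    cases hg : g x with
    | none => rw [iterate_step_none, iterate_step_none]
    | some y => exact ih (hcl x hx y hg)

/-- `g` is the parent map of a tree with vertex set `A ∪ {none}`. -/
structure IsTreeOn (A : Finset W) (g : W → Option W) : Prop where
  acyclic : IsAcyclic g
  off : ∀ x ∉ A, g x = none
  closed : ∀ x ∈ A, ∀ y, g x = some y → y ∈ A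

variable [DecidableEq W]

lemma IsTreeOn.update {A : Finset W} {g : W → Option W} (h : IsTreeOn A g) {x w : W} (hx : x ∉ A)
    (hw : w ∈ A) : IsTreeOn (insert x A) (Function.update g x (some w)) := by
  have hag : ∀ y ∈ A, Function.update g x (some w) y = g y := fun y hy =>
    Function.update_of_ne (by rintro rfl; exact hx hy) _ _
  have hA : ∀ y ∈ A, ∃ k, (step (Function.update g x (some w)))^[k] (some y) = none := by
    intro y hy
    obtain ⟨k, hk⟩ := h.acyclic y
    exact ⟨k, by rw [iterate_step_eq_of_agree h.closed hag k hy, hk]⟩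
  refine ⟨fun y => ?_, fun y hy => ?_, fun y hy z hz => ?_⟩
  · by_cases hyA : y ∈ A
    · exact hA y hyA
    · by_cases hyx : y = x
      · subst hyx
        obtain ⟨k, hk⟩ := hA w hw
        exact ⟨k + 1, by rw [Function.iterate_succ_apply, step_some, Function.update_self, hk]⟩
      · exact ⟨1, by simp [Function.update_of_ne hyx, h.off y hyA]⟩
  · rw [Finset.mem_insert, not_or] at hy
    rw [Function.update_of_ne hy.1, h.off y hy.2]
  · rcases Finset.mem_insert.1 hy with rfl | hy
    · rw [Function.update_self, Option.some.injEq] at hz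
      exact Finset.mem_insert_of_mem (hz ▸ hw)
    · rw [hag y hy] at hz
      exact Finset.mem_insert_of_mem (h.closed y hy z hz)

/-- The unit vector of a vertex, and zero at the root. -/
def unitVec (o : Option W) : W → ℝ := fun y => if o = some y then 1 else 0

/-- The matrix with rows `e_x - e_{f x}`. -/
def lap (f : W → Option W) : Matrix W W ℝ := fun x => unitVec (some x) - unitVec (f x)

lemma sum_unitVec_mul [Fintype W] (o : Option W) (v : W → ℝ) :
    ∑ y, unitVec o y * v y = o.elim 0 v := by
  cases o <;> simp [unitVec]

variable [Fintype W]

lemma lap_mulVec (f : W → Option W) (v : W → ℝ) (x : W) :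
    (lap f).mulVec v x = v x - (f x).elim 0 v := by
  simp only [Matrix.mulVec, dotProduct, lap, Pi.sub_apply, sub_mul, Finset.sum_sub_distrib,
    sum_unitVec_mul]
  rfl

/-- Ordered by depth, the matrix is triangular with unit diagonal, because parents are strictly
shallower. -/
lemma det_lap_of_isAcyclic {f : W → Option W} (hf : IsAcyclic f) : (lap f).det = 1 := by
  have hbt : (lap f).BlockTriangular (fun x => OrderDual.toDual (depth f x)) := by
    intro x y hxy
    have hxy' : depth f x < depth f y := hxy
    have h1 : x ≠ y := by rintro rfl; exact lt_irrefl _ hxy'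
    have h2 : f x ≠ some y := fun h => (depth_lt hf h).not_gt hxy'
    simp [lap, unitVec, h1, h2]
  rw [hbt.det]
  refine Finset.prod_eq_one fun a _ => ?_
  have : (lap f).toSquareBlock (fun x => OrderDual.toDual (depth f x)) a = 1 := by
    ext ⟨x, hx⟩ ⟨y, hy⟩
    have h2 : f x ≠ some y := fun h => (depth_lt hf h).ne
      (by rw [← OrderDual.toDual_inj, hx, hy])
    simp [Matrix.toSquareBlock, Matrix.toSquareBlockProp, lap, unitVec, h2, Matrix.one_apply]
  rw [this, Matrix.det_one]

open Classical in
-- The indicator of the vertices that never reach the root is a nonzero vector in the kernel.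
lemma det_lap_of_not_isAcyclic {f : W → Option W} (hf : ¬ IsAcyclic f) : (lap f).det = 0 := by
  rw [IsAcyclic] at hf
  push Not at hf
  obtain ⟨x, hx⟩ := hf
  refine Matrix.exists_mulVec_eq_zero_iff.1
    ⟨fun y => if ∀ k, (step f)^[k] (some y) ≠ none then 1 else 0, fun h => ?_, ?_⟩
  · have := congrFun h x
    simp [hx] at this
  · funext y
    rw [lap_mulVec]
    have h0 : (∀ k, (step f)^[k] (some y) ≠ none) ↔ ∀ k, (step f)^[k] (f y) ≠ none :=
      ⟨fun h k => h (k + 1), fun h k => by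
        cases k with
        | zero => simp
        | succ k => exact h k⟩
    cases hy : f y with
    | none =>
      rw [if_neg]
      · simp
      · rw [h0, hy]; exact fun h => h 0 rfl
    | some z =>
      rw [hy] at h0
      simp [h0]

open Classical in
-- Expand the determinant by multilinearity in the rows: each choice of one summand per row is a
-- parent map, and only acyclic maps survive, with determinant one.
lemma det_sum_smul (q : W → Option W → ℝ) :
    Matrix.det (fun x => ∑ o, q x o • (unitVec (some x) - unitVec o))
      = ∑ f : W → Option W with IsAcyclic f, ∏ x, q x (f x) := by
  have h := (Matrix.detRowAlternating (n := W) (R := ℝ)).toMultilinearMap.map_sum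
    (fun x (o : Option W) => q x o • (unitVec (some x) - unitVec o))
  refine h.trans ?_
  rw [Finset.sum_filter]
  refine Finset.sum_congr rfl fun f _ => ?_
  rw [MultilinearMap.map_smul_univ, smul_eq_mul]
  change _ * Matrix.det (lap f) = _
  split_ifs with hf
  · rw [det_lap_of_isAcyclic hf, mul_one]
  · rw [det_lap_of_not_isAcyclic hf, mul_zero]

open Classical in
/-- The parent maps of the spanning trees that extend the tree `g` on `A`. -/
def extensions (A : Finset W) (g : W → Option W) : Finset (W → Option W) :=
  Finset.univ.filter fun f => IsAcyclic f ∧ ∀ x ∈ A, f x = g x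

/-- The weighted sum of `Φ` over the spanning trees that extend the tree `g` on `A`. -/
def treeSum (q : W → Option W → ℝ) (A : Finset W) (g : W → Option W)
    (Φ : (W → Option W) → ℝ) : ℝ :=
  ∑ f ∈ extensions A g, (∏ x ∈ Aᶜ, q x (f x)) * Φ f

/-- The transition matrix of the walk killed at the root. -/
def transMatrix (q : W → Option W → ℝ) : Matrix W W ℝ := fun x y => q x (some y)

open LoopErased

/-- The matrix-tree theorem. -/
lemma treeSum_one {q : W → Option W → ℝ} (hq : ∀ x, ∑ o, q x o = 1) {A : Finset W}
    {g : W → Option W} (hg : IsTreeOn A g) :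
    treeSum q A g (fun _ => 1) = (1 - killRows (transMatrix q) A).det := by
  classical
  -- Weights that force the parent to be `g x` on `A`; the expansion of their determinant runs over
  -- the extensions of `g` only.
  set q' : W → Option W → ℝ := fun x o => if x ∈ A then (if o = g x then 1 else 0) else q x o
    with hq'
  -- Rows of `1 - K` in `A` are unit vectors, so multiplying by `lap g`, of determinant one, turns
  -- them into `e_x - e_{g x}`. The other rows are untouched, as `g` is `none` there.
  have h1 : (lap g * (1 - killRows (transMatrix q) A) : Matrix W W ℝ)
      = fun x => ∑ o, q' x o • (unitVec (some x) - unitVec o) := by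
    have hrow : ∀ x ∈ A, (1 - killRows (transMatrix q) A) x = unitVec (some x) := by
      intro x hx; funext y; simp [killRows, hx, unitVec, Matrix.one_apply]
    ext x y
    have h2 : (lap g * (1 - killRows (transMatrix q) A)) x y
        = (1 - killRows (transMatrix q) A) x y
          - (g x).elim 0 (fun k => (1 - killRows (transMatrix q) A) k y) :=
      lap_mulVec g (fun k => (1 - killRows (transMatrix q) A) k y) x
    rw [h2]
    simp only [Finset.sum_apply, Pi.smul_apply, Pi.sub_apply, smul_eq_mul, hq']
    by_cases hx : x ∈ A
    · simp only [hx, if_true, ite_mul, one_mul, zero_mul, Finset.sum_ite_eq', Finset.mem_univ]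
      rw [hrow x hx]
      congr 1
      cases hgx : g x with
      | none => simp [unitVec]
      | some z => exact congrFun (hrow z (hg.closed x hx z hgx)) y
    · simp only [hx, if_false, hg.off x hx, Option.elim_none, sub_zero, mul_sub,
        Finset.sum_sub_distrib, ← Finset.sum_mul, hq, one_mul]
      simp [killRows, hx, unitVec, Matrix.one_apply, transMatrix]
  have h3 : (1 - killRows (transMatrix q) A).det
      = ∑ f : W → Option W with IsAcyclic f, ∏ x, q' x (f x) := by
    rw [← det_sum_smul, ← h1, Matrix.det_mul, det_lap_of_isAcyclic hg.acyclic, one_mul]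
  rw [h3, treeSum, extensions, ← Finset.filter_filter, Finset.sum_filter]
  refine Finset.sum_congr rfl fun f _ => ?_
  rw [← Finset.prod_mul_prod_compl A]
  have h4 : ∏ x ∈ Aᶜ, q' x (f x) = ∏ x ∈ Aᶜ, q x (f x) :=
    Finset.prod_congr rfl fun x hx => by simp [hq', Finset.mem_compl.1 hx]
  rw [h4]
  split_ifs with h
  · have h5 : ∏ x ∈ A, q' x (f x) = 1 :=
      Finset.prod_eq_one fun x hx => by simp [hq', hx, h x hx]
    rw [h5]; ring
  · push Not at h
    obtain ⟨x, hx, hne⟩ := h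
    rw [Finset.prod_eq_zero hx (by simp [hq', hx, hne]), zero_mul]

/-- Cramer's rule: replacing row `x` by a unit vector gives the `(x, x)` entry of the adjugate,
which is the determinant times the inverse `green Q A`. -/
lemma det_one_sub_killRows_insert {Q : Matrix W W ℝ} {β : ℝ} (hQ : HasBubble Q β) {A : Finset W}
    {x : W} (hx : x ∉ A) : (1 - killRows Q (insert x A)).det
      = (1 - killRows Q A).det * green Q A x x := by
  have h1 : (1 - killRows Q A).updateRow x (Pi.single x 1) = 1 - killRows Q (insert x A) := by
    ext y z
    rw [Matrix.updateRow_apply]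
    by_cases hy : y = x
    · subst hy; simp [killRows, Matrix.one_apply, Pi.single_apply, eq_comm]
    · simp [killRows, hy]
  rw [← h1, ← Matrix.adjugate_apply]
  have h2 : (1 - killRows Q A).adjugate = (1 - killRows Q A).det • green Q A := by
    have h3 := congrArg ((1 - killRows Q A).adjugate * ·) (one_sub_mul_green hQ A)
    simpa only [← Matrix.mul_assoc, Matrix.adjugate_mul, Matrix.smul_mul, Matrix.one_mul,
      Matrix.mul_one] using h3.symm
  rw [h2]; rfl

/-- The number of descendants of `w`, within fewer than `n` generations and attached off `A`. -/
def descCount (f : W → Option W) : ℕ → Finset W → W → ℕ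
  | 0, _, _ => 0
  | n + 1, A, w => 1 + ∑ x ∈ Aᶜ, if f x = some w then descCount f n (insert x A) x else 0

/-- Prescribing the parent of `x` amounts to adjoining `x` to the revealed subtree. This permits
exploring descendants one generation at a time. -/
lemma treeSum_edge (q : W → Option W → ℝ) {A : Finset W} (g : W → Option W) {x : W} (hx : x ∉ A)
    (o : Option W) (Φ : (W → Option W) → ℝ) :
    treeSum q A g (fun f => if f x = o then Φ f else 0)
      = q x o * treeSum q (insert x A) (Function.update g x o) Φ := by
  classical
  have hE : extensions (insert x A) (Function.update g x o)
      = (extensions A g).filter fun f => f x = o := by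
    ext f
    simp only [extensions, Finset.mem_filter, Finset.mem_univ, true_and, Finset.mem_insert,
      forall_eq_or_imp, Function.update_self]
    have : (∀ y ∈ A, f y = Function.update g x o y) ↔ ∀ y ∈ A, f y = g y :=
      forall₂_congr fun y hy => by rw [Function.update_of_ne (by rintro rfl; exact hx hy)]
    rw [this]; tauto
  rw [treeSum, treeSum, hE, Finset.sum_filter, Finset.mul_sum]
  refine Finset.sum_congr rfl fun f _ => ?_
  split_ifs with h
  · have hA : Aᶜ = insert x (insert x A)ᶜ := by
      ext z; by_cases hz : z = x <;> simp [hz, hx]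
    rw [hA, Finset.prod_insert (by simp), h]; ring
  · simp

lemma treeSum_descCount_succ {q : W → Option W → ℝ} (hq : ∀ x, ∑ o, q x o = 1) {A : Finset W}
    {g : W → Option W} (hg : IsTreeOn A g) (n : ℕ) (w : W) :
    treeSum q A g (fun f => descCount f (n + 1) A w)
      = (1 - killRows (transMatrix q) A).det + ∑ x ∈ Aᶜ, q x (some w) *
        treeSum q (insert x A) (Function.update g x (some w))
          (fun f => descCount f n (insert x A) x) := by
  rw [← treeSum_one hq hg]
  have h : ∀ x ∈ Aᶜ, q x (some w) * treeSum q (insert x A) (Function.update g x (some w))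
      (fun f => (descCount f n (insert x A) x : ℝ)) = treeSum q A g
        (fun f => if f x = some w then (descCount f n (insert x A) x : ℝ) else 0) :=
    fun x hx => (treeSum_edge q g (Finset.mem_compl.1 hx) _ _).symm
  rw [Finset.sum_congr rfl h]
  simp only [treeSum]
  rw [Finset.sum_comm, ← Finset.sum_add_distrib]
  refine Finset.sum_congr rfl fun f _ => ?_
  rw [← Finset.mul_sum, ← mul_add]
  simp [descCount]

/-- The data of a finite reversible walk with a root: stochastic weights `q`, reversible with
respect to `c`, with bubble bound `β`. -/
structure IsReversible (q : W → Option W → ℝ) (c : W → ℝ) (β : ℝ) : Prop where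
  nonneg : ∀ x o, 0 ≤ q x o
  sum_eq_one : ∀ x, ∑ o, q x o = 1
  c_pos : ∀ x, 0 < c x
  symm : ∀ x y, c x * q x (some y) = c y * q y (some x)
  bubble : HasBubble (transMatrix q) β

variable {q : W → Option W → ℝ} {c : W → ℝ} {β : ℝ}

lemma treeSum_nonneg (h : IsReversible q c β) (A : Finset W) (g : W → Option W)
    {Φ : (W → Option W) → ℝ} (hΦ : ∀ f, 0 ≤ Φ f) : 0 ≤ treeSum q A g Φ :=
  Finset.sum_nonneg fun f _ => mul_nonneg (Finset.prod_nonneg fun x _ => h.nonneg x _) (hΦ f)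

/-- Descendant paths are followed towards the root by the tree and away from it by `loopErasedSum`.
Reversing each step gives conductance ratios that telescope to `c x / c z`, with `z` the endpoint,
while the growing determinants supply the Green factors. The result does not depend on `g`. -/
lemma treeSum_descCount (h : IsReversible q c β) (n : ℕ) {A : Finset W} {x : W} (hx : x ∉ A)
    {g : W → Option W} (hg : IsTreeOn (insert x A) g) :
    treeSum q (insert x A) g (fun f => descCount f n (insert x A) x)
      = (1 - killRows (transMatrix q) A).det *
        (c x * loopErasedSum (transMatrix q) (fun z => (c z)⁻¹) n A x) := by
  induction n generalizing A x g with
  | zero => simp [descCount, loopErasedSum, treeSum]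
  | succ n ih =>
    rw [treeSum_descCount_succ h.sum_eq_one hg]
    have h1 : ∀ y ∈ (insert x A)ᶜ, q y (some x) * treeSum q (insert y (insert x A))
        (Function.update g y (some x)) (fun f => (descCount f n (insert y (insert x A)) y : ℝ))
        = (1 - killRows (transMatrix q) (insert x A)).det * (c x * (transMatrix q x y *
          loopErasedSum (transMatrix q) (fun z => (c z)⁻¹) n (insert x A) y)) := by
      intro y hy
      have hy' := Finset.mem_compl.1 hy
      rw [ih hy' (hg.update hy' (Finset.mem_insert_self x A)),
        show transMatrix q x y = q x (some y) from rfl]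
      linear_combination -(1 - killRows (transMatrix q) (insert x A)).det
        * loopErasedSum (transMatrix q) (fun z => (c z)⁻¹) n (insert x A) y * h.symm x y
    rw [Finset.sum_congr rfl h1, ← Finset.mul_sum, ← Finset.mul_sum,
      det_one_sub_killRows_insert h.bubble hx]
    simp only [loopErasedSum]
    have := (h.c_pos x).ne'
    field_simp

/-- Conditionally on a subtree containing the root, the expected number of descendants of one of
its vertices within a given number of generations grows at most linearly. -/
lemma treeSum_descCount_le (h : IsReversible q c β) {m M : ℝ} (hm : 0 < m) (hmc : ∀ x, m ≤ c x)
    (hcM : ∀ x, c x ≤ M) (n : ℕ) {A : Finset W} {g : W → Option W} (hg : IsTreeOn A g) {w : W}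
    (hw : w ∈ A) : treeSum q A g (fun f => descCount f (n + 1) A w)
      ≤ M / m * β * (n + 1) * treeSum q A g (fun _ => 1) := by
  -- `β ≥ 1` and `M / m ≥ 1` absorb the 1 that counts `w` itself, turning `1 + (M / m) β n` into the
  -- stated bound.
  have hβ1 : 1 ≤ β := by
    have := green_mul_green_le h.bubble ∅ w
    refine le_trans ?_ this
    rw [Matrix.mul_apply]
    refine le_trans ?_ (Finset.single_le_sum (fun z _ => mul_nonneg (green_nonneg h.bubble ∅ w z)
      (green_nonneg h.bubble ∅ z w)) (Finset.mem_univ w))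
    nlinarith [one_le_green h.bubble ∅ w]
  have hMm : 1 ≤ M / m := by
    rw [one_le_div hm]; exact (hmc w).trans (hcM w)
  rw [treeSum_descCount_succ h.sum_eq_one hg]
  have hT := treeSum_nonneg h A g (Φ := fun _ => 1) fun _ => zero_le_one
  rw [treeSum_one h.sum_eq_one hg] at hT ⊢
  set T := (1 - killRows (transMatrix q) A).det
  have hrow : ∀ x, ∑ y, transMatrix q x y ≤ 1 := fun x => by
    have := h.sum_eq_one x
    rw [Fintype.sum_option] at this
    simp only [transMatrix]
    linarith [h.nonneg x none]
  have h1 : ∀ y ∈ Aᶜ, q y (some w) * treeSum q (insert y A)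
      (Function.update g y (some w)) (fun f => (descCount f n (insert y A) y : ℝ))
      ≤ T * (c w * (q w (some y) * (β * n * m⁻¹))) := by
    intro y hy
    have hy' := Finset.mem_compl.1 hy
    rw [treeSum_descCount h n hy' (hg.update hy' hw)]
    have h2 := loopErasedSum_le h.bubble hrow (h := fun z => (c z)⁻¹) (M := m⁻¹) (by positivity)
      (fun x => inv_anti₀ hm (hmc x)) n hy'
    calc _ = T * (c w * (q w (some y) *
          loopErasedSum (transMatrix q) (fun z => (c z)⁻¹) n A y)) := by
            linear_combination (-T * loopErasedSum (transMatrix q) (fun z => (c z)⁻¹) n A y)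
              * h.symm w y
      _ ≤ _ := by
        refine mul_le_mul_of_nonneg_left (mul_le_mul_of_nonneg_left
          (mul_le_mul_of_nonneg_left h2 (h.nonneg _ _)) (h.c_pos w).le) hT
  have h3 : ∑ y ∈ Aᶜ, q w (some y) ≤ 1 :=
    (Finset.sum_le_univ_sum_of_nonneg fun y => h.nonneg w (some y)).trans (hrow w)
  have hb : 0 ≤ β * n * m⁻¹ := by positivity
  calc _ ≤ T + ∑ y ∈ Aᶜ, T * (c w * (q w (some y) * (β * n * m⁻¹))) :=
        add_le_add_right (Finset.sum_le_sum h1) _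
    _ = T + T * (c w * ((∑ y ∈ Aᶜ, q w (some y)) * (β * n * m⁻¹))) := by
        rw [Finset.sum_mul, Finset.mul_sum, Finset.mul_sum]
    _ ≤ T + T * (M * (1 * (β * n * m⁻¹))) := by
        refine add_le_add_right (mul_le_mul_of_nonneg_left (mul_le_mul (hcM w)
          (mul_le_mul_of_nonneg_right h3 hb)
          (mul_nonneg (Finset.sum_nonneg fun y _ => h.nonneg w _) hb)
          ((h.c_pos w).le.trans (hcM w))) hT) _
    _ = (1 + M / m * β * n) * T := by ring
    _ ≤ M / m * β * (n + 1) * T := by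
        refine mul_le_mul_of_nonneg_right ?_ hT
        nlinarith [one_le_mul_of_one_le_of_one_le hMm hβ1]

end ParentMap

/-! ### Moments of balls in random rooted trees -/

namespace ParentMap

open LoopErased

variable {W : Type*}

section

variable [Fintype W] [DecidableEq W]

/-- The set counted by `descCount`. -/
def descSet (f : W → Option W) : ℕ → Finset W → W → Finset W
  | 0, _, _ => ∅
  | n + 1, A, w => insert w ((Aᶜ.filter fun x => f x = some w).biUnion fun x =>
      descSet f n (insert x A) x)

lemma card_descSet_le (f : W → Option W) (n : ℕ) (A : Finset W) (w : W) :
    (descSet f n A w).card ≤ descCount f n A w := by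
  induction n generalizing A w with
  | zero => simp [descSet]
  | succ n ih =>
    simp only [descSet, descCount]
    refine (Finset.card_insert_le _ _).trans ?_
    rw [add_comm, ← Finset.sum_filter]
    exact add_le_add_right (Finset.card_biUnion_le.trans (Finset.sum_le_sum fun x _ => ih _ _)) _

lemma mem_descSet {f : W → Option W} (hf : IsAcyclic f) {u : W} {n l : ℕ} (hl : l < n)
    {A : Finset W} {w : W} (hw : (step f)^[l] (some u) = some w)
    (hA : ∀ i < l, ∀ y, (step f)^[i] (some u) = some y → y ∉ A) : u ∈ descSet f n A w := by
  induction n generalizing l A w with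
  | zero => exact absurd hl (Nat.not_lt_zero l)
  | succ n ih =>
    rw [descSet, Finset.mem_insert]
    cases l with
    | zero => left; simpa using hw
    | succ l =>
      right
      rw [Function.iterate_succ_apply'] at hw
      cases hx : (step f)^[l] (some u) with
      | none => rw [hx] at hw; simp [step] at hw
      | some x =>
        rw [hx, step_some] at hw
        have hxA := hA l (Nat.lt_succ_self l) x hx
        refine Finset.mem_biUnion.2 ⟨x, Finset.mem_filter.2 ⟨Finset.mem_compl.2 hxA, hw⟩, ?_⟩
        refine ih (Nat.lt_of_succ_lt_succ hl) hx fun i hi y hy => ?_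
        rw [Finset.mem_insert, not_or]
        refine ⟨?_, hA i (hi.trans (Nat.lt_succ_self l)) y hy⟩
        rintro rfl
        exact hi.ne (iterate_step_injective hf hy hx)

end

/-! ### Balls and revealed subtrees of rooted trees -/

section

variable [Fintype W]

open Classical in
/-- The vertices at distance at most `n` from `v` in the tree with parent map `f` and the root
removed. -/
def treeBall (f : W → Option W) (v : W) (n : ℕ) : Finset W :=
  Finset.univ.filter fun u => ∃ i j w, i + j ≤ n ∧ (step f)^[i] (some v) = some w ∧
    (step f)^[j] (some u) = some w

lemma mem_treeBall {f : W → Option W} {v u : W} {n : ℕ} : u ∈ treeBall f v n ↔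
    ∃ i j w, i + j ≤ n ∧ (step f)^[i] (some v) = some w ∧ (step f)^[j] (some u) = some w := by
  simp [treeBall]

open Classical in
/-- The ancestors of the vertices in `U`, including `U` itself. -/
def ancestors (f : W → Option W) (U : Finset W) : Finset W :=
  Finset.univ.filter fun x => ∃ u ∈ U, ∃ i, (step f)^[i] (some u) = some x

lemma mem_ancestors {f : W → Option W} {U : Finset W} {x : W} : x ∈ ancestors f U ↔
    ∃ u ∈ U, ∃ i, (step f)^[i] (some u) = some x := by
  simp [ancestors]

lemma subset_ancestors (f : W → Option W) (U : Finset W) : U ⊆ ancestors f U :=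
  fun u hu => mem_ancestors.2 ⟨u, hu, 0, rfl⟩

lemma ancestors_closed (f : W → Option W) (U : Finset W) :
    ∀ x ∈ ancestors f U, ∀ y, f x = some y → y ∈ ancestors f U := by
  intro x hx y hy
  obtain ⟨u, hu, i, hi⟩ := mem_ancestors.1 hx
  exact mem_ancestors.2 ⟨u, hu, i + 1, by rw [Function.iterate_succ_apply', hi, step_some, hy]⟩

open Classical in
/-- The subtree spanned by the root and `U`. -/
def spanned (U : Finset W) (f : W → Option W) : W → Option W :=
  fun x => if x ∈ ancestors f U then f x else none

lemma isTreeOn_spanned {f : W → Option W} (hf : IsAcyclic f) (U : Finset W) :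
    IsTreeOn (ancestors f U) (spanned U f) := by
  refine ⟨fun x => ?_, fun x hx => if_neg hx, fun x hx y hy => ?_⟩
  · by_cases hx : x ∈ ancestors f U
    · obtain ⟨k, hk⟩ := hf x
      exact ⟨k, by rw [iterate_step_eq_of_agree (f := spanned U f) (g := f)
        (ancestors_closed f U) (fun y hy => if_pos hy) k hx, hk]⟩
    · exact ⟨1, by simp [spanned, hx]⟩
  · rw [spanned, if_pos hx] at hy
    exact ancestors_closed f U x hx y hy

lemma iterate_step_eq_of_mem_extensions {f₀ f : W → Option W} {U : Finset W}
    (h : ∀ x ∈ ancestors f₀ U, f x = f₀ x) {u : W} (hu : u ∈ U) (k : ℕ) :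
    (step f)^[k] (some u) = (step f₀)^[k] (some u) :=
  iterate_step_eq_of_agree (ancestors_closed f₀ U) h k (subset_ancestors f₀ U hu)

lemma ancestors_eq_of_agree {f₀ f : W → Option W} {U : Finset W}
    (h : ∀ x ∈ ancestors f₀ U, f x = f₀ x) : ancestors f U = ancestors f₀ U := by
  ext x
  rw [mem_ancestors, mem_ancestors]
  exact exists_congr fun u => and_congr_right fun hu => exists_congr fun i => by
    rw [iterate_step_eq_of_mem_extensions h hu]

lemma spanned_eq_iff {f₀ f : W → Option W} {U : Finset W} :
    spanned U f = spanned U f₀ ↔ ∀ x ∈ ancestors f₀ U, f x = f₀ x := by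
  constructor
  · intro h
    have h1 : ∀ x ∈ U, ∀ k, (step f)^[k] (some x) = (step f₀)^[k] (some x) := by
      intro u hu k
      induction k with
      | zero => rfl
      | succ k ih =>
        rw [Function.iterate_succ_apply', Function.iterate_succ_apply', ih]
        cases hx : (step f₀)^[k] (some u) with
        | none => rfl
        | some x =>
          have h2 := congrFun h x
          rwa [spanned, spanned, if_pos (mem_ancestors.2 ⟨u, hu, k, ih.trans hx⟩),
            if_pos (mem_ancestors.2 ⟨u, hu, k, hx⟩)] at h2
    intro x hx
    obtain ⟨u, hu, k, hk⟩ := mem_ancestors.1 hx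
    have h2 := h1 u hu (k + 1)
    rwa [Function.iterate_succ_apply', Function.iterate_succ_apply', h1 u hu k, hk] at h2
  · intro h
    funext x
    have he := ancestors_eq_of_agree h
    by_cases hx : x ∈ ancestors f₀ U
    · rw [spanned, spanned, if_pos hx, if_pos (he ▸ hx), h x hx]
    · rw [spanned, spanned, if_neg hx, if_neg (he ▸ hx)]

end

lemma mem_treeBall_iff_of_agree [Fintype W] [DecidableEq W] {f₀ f : W → Option W} {v : W}
    {U : Finset W}
    (h : ∀ x ∈ ancestors f₀ (insert v U), f x = f₀ x) {u : W} (hu : u ∈ U) (n : ℕ) :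
    u ∈ treeBall f v n ↔ u ∈ treeBall f₀ v n := by
  rw [mem_treeBall, mem_treeBall]
  simp only [iterate_step_eq_of_mem_extensions h (Finset.mem_insert_self v U),
    iterate_step_eq_of_mem_extensions h (Finset.mem_insert_of_mem hu)]

section

variable [DecidableEq W]

/-- The ancestors of the vertices in `U` within at most `n` generations. -/
def nearAncestors (f : W → Option W) (U : Finset W) (n : ℕ) : Finset W :=
  U.biUnion fun u => (Finset.range (n + 1)).biUnion fun s => ((step f)^[s] (some u)).toFinset

lemma mem_nearAncestors {f : W → Option W} {U : Finset W} {n : ℕ} {w : W} :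
    w ∈ nearAncestors f U n ↔ ∃ u ∈ U, ∃ s ≤ n, (step f)^[s] (some u) = some w := by
  simp [nearAncestors]

lemma card_nearAncestors_le (f : W → Option W) (U : Finset W) (n : ℕ) :
    (nearAncestors f U n).card ≤ U.card * (n + 1) := by
  refine Finset.card_biUnion_le_card_mul _ _ _ fun u _ => ?_
  refine (Finset.card_biUnion_le_card_mul _ _ 1 fun s _ => ?_).trans (by simp)
  rw [Option.card_toFinset]
  cases (step f)^[s] (some u) <;> simp

end

variable [Fintype W] [DecidableEq W]

lemma nearAncestors_subset (f : W → Option W) (U : Finset W) (n : ℕ) :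
    nearAncestors f U n ⊆ ancestors f U := fun w hw => by
  obtain ⟨u, hu, s, _, hs⟩ := mem_nearAncestors.1 hw
  exact mem_ancestors.2 ⟨u, hu, s, hs⟩

/-- If `U` is contained in the ball, then each vertex of the ball descends from a near ancestor. -/
lemma treeBall_subset {f : W → Option W} (hf : IsAcyclic f) {v : W} {n : ℕ} {U : Finset W}
    (hU : U ⊆ treeBall f v n) : treeBall f v n ⊆
      (nearAncestors f (insert v U) n).biUnion
        (descSet f (n + 1) (ancestors f (insert v U))) := by
  classical
  intro u hu
  obtain ⟨i, j, z, hij, hi, hj⟩ := mem_treeBall.1 hu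
  set A := ancestors f (insert v U) with hA
  have hex : ∃ l, ∃ w ∈ A, (step f)^[l] (some u) = some w :=
    ⟨j, z, mem_ancestors.2 ⟨v, Finset.mem_insert_self v U, i, hi⟩, hj⟩
  -- The ancestral line of `u` enters the revealed subtree first at `w`, no later than at the common
  -- ancestor `z` of `u` and `v`.
  set l := Nat.find hex with hl
  obtain ⟨w, hwA, hlw⟩ := Nat.find_spec hex
  rw [← hl] at hlw
  have hlj : l ≤ j := Nat.find_min' hex
    ⟨z, mem_ancestors.2 ⟨v, Finset.mem_insert_self v U, i, hi⟩, hj⟩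
  have hwz : (step f)^[j - l] (some w) = some z := by
    rw [← hlw, ← Function.iterate_add_apply, Nat.sub_add_cancel hlj, hj]
  -- If `w` lies above `v`, it lies on the path from `v` up to `z`, so its height over `v` is at
  -- most `i ≤ n`.
  have hv : ∀ s, (step f)^[s] (some v) = some w → w ∈ nearAncestors f (insert v U) n := by
    intro s hs
    have : (step f)^[j - l + s] (some v) = some z := by
      rw [Function.iterate_add_apply, hs, hwz]
    have := iterate_step_injective hf this hi
    exact mem_nearAncestors.2 ⟨v, Finset.mem_insert_self v U, s, by omega, hs⟩
  refine Finset.mem_biUnion.2 ⟨w, ?_, mem_descSet hf (by omega) hlw fun i hil y hy hyA =>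
    Nat.find_min hex hil ⟨y, hyA, hy⟩⟩
  obtain ⟨u₀, hu₀, s, hs⟩ := mem_ancestors.1 hwA
  rcases Finset.mem_insert.1 hu₀ with rfl | hu₀U
  · exact hv s hs
  · obtain ⟨i₀, j₀, z₀, hij₀, hi₀, hj₀⟩ := mem_treeBall.1 (hU hu₀U)
    rcases le_or_gt s j₀ with hsj | hsj
    · exact mem_nearAncestors.2 ⟨u₀, hu₀, s, by omega, hs⟩
    -- Here `w` lies above the common ancestor of `u₀` and `v`, hence above `v`.
    · refine hv (s - j₀ + i₀) ?_
      rw [Function.iterate_add_apply, hi₀, ← hj₀, ← Function.iterate_add_apply,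
        Nat.sub_add_cancel hsj.le, hs]

variable {q : W → Option W → ℝ} {c : W → ℝ} {β : ℝ}

open Classical in
-- Sort the trees by the subtree spanned by the root, `v` and `U`. It decides whether `U` lies in
-- the ball, and given it the ball is covered by the descendants of at most `|insert v U| (n + 1)`
-- near ancestors, each with `(M / m) β (n + 1)` expected descendants.
lemma sum_card_treeBall_le (h : IsReversible q c β) {m M : ℝ} (hm : 0 < m) (hmc : ∀ x, m ≤ c x)
    (hcM : ∀ x, c x ≤ M) (n : ℕ) (v : W) (U : Finset W) :
    ∑ f : W → Option W with IsAcyclic f, (∏ x, q x (f x)) *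
        (if U ⊆ treeBall f v n then ((treeBall f v n).card : ℝ) else 0)
      ≤ (insert v U).card * (M / m * β * (n + 1) ^ 2) *
        ∑ f : W → Option W with IsAcyclic f, (∏ x, q x (f x)) *
          (if U ⊆ treeBall f v n then 1 else 0) := by
  set U' := insert v U with hU'
  set K : ℝ := U'.card * (M / m * β * (n + 1) ^ 2) with hK
  rw [← Finset.sum_fiberwise _ (spanned U') fun f => (∏ x, q x (f x)) *
      (if U ⊆ treeBall f v n then ((treeBall f v n).card : ℝ) else 0),
    ← Finset.sum_fiberwise _ (spanned U') fun f => (∏ x, q x (f x)) *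
      (if U ⊆ treeBall f v n then (1 : ℝ) else 0), Finset.mul_sum]
  refine Finset.sum_le_sum fun g _ => ?_
  rcases Finset.eq_empty_or_nonempty
    (Finset.filter (fun f => spanned U' f = g) (Finset.univ.filter IsAcyclic)) with he | ⟨f₀, hf₀m⟩
  · rw [he]; simp
  obtain ⟨hf₁, rfl⟩ := Finset.mem_filter.1 hf₀m
  have hf₀ : IsAcyclic f₀ := (Finset.mem_filter.1 hf₁).2
  set A := ancestors f₀ U' with hA
  have hg := isTreeOn_spanned hf₀ U'
  have hfib : Finset.filter (fun f => spanned U' f = spanned U' f₀) (Finset.univ.filter IsAcyclic)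
      = extensions A (spanned U' f₀) := by
    ext f
    simp only [extensions, Finset.mem_filter, Finset.mem_univ, true_and, spanned_eq_iff]
    refine and_congr_right fun _ => forall₂_congr fun x hx => ?_
    rw [spanned, if_pos hx]
  rw [hfib]
  have hagree : ∀ f ∈ extensions A (spanned U' f₀), IsAcyclic f ∧ ∀ x ∈ A, f x = f₀ x := by
    intro f hf
    rw [← hfib] at hf
    obtain ⟨h1, h2⟩ := Finset.mem_filter.1 hf
    exact ⟨(Finset.mem_filter.1 h1).2, spanned_eq_iff.1 h2⟩
  have hball : ∀ f ∈ extensions A (spanned U' f₀),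
      (U ⊆ treeBall f v n ↔ U ⊆ treeBall f₀ v n) := fun f hf =>
    forall₂_congr fun u hu => mem_treeBall_iff_of_agree (hagree f hf).2 hu n
  by_cases hU : U ⊆ treeBall f₀ v n
  swap
  · rw [Finset.sum_eq_zero fun f hf => by rw [if_neg (by rwa [hball f hf]), mul_zero],
      Finset.sum_eq_zero fun f hf => by rw [if_neg (by rwa [hball f hf]), mul_zero], mul_zero]
  have hprod : ∀ f ∈ extensions A (spanned U' f₀), ∏ x, q x (f x)
      = (∏ x ∈ A, q x (f₀ x)) * ∏ x ∈ Aᶜ, q x (f x) := fun f hf => by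
    rw [← Finset.prod_mul_prod_compl A]
    congr 1
    exact Finset.prod_congr rfl fun x hx => by rw [(hagree f hf).2 x hx]
  have hP : 0 ≤ ∏ x ∈ A, q x (f₀ x) := Finset.prod_nonneg fun x _ => h.nonneg x _
  have hR : ∑ f ∈ extensions A (spanned U' f₀), (∏ x, q x (f x)) *
      (if U ⊆ treeBall f v n then (1 : ℝ) else 0)
      = (∏ x ∈ A, q x (f₀ x)) * treeSum q A (spanned U' f₀) fun _ => 1 := by
    rw [treeSum, Finset.mul_sum]
    exact Finset.sum_congr rfl fun f hf => by
      rw [if_pos ((hball f hf).2 hU), hprod f hf]; ring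
  set D := nearAncestors f₀ U' n with hD
  have hcard : ∀ f ∈ extensions A (spanned U' f₀),
      ((treeBall f v n).card : ℝ) ≤ ∑ w ∈ D, (descCount f (n + 1) A w : ℝ) := by
    intro f hf
    have h1 := treeBall_subset (hagree f hf).1 ((hball f hf).2 hU)
    have h2 : nearAncestors f (insert v U) n = D := by
      ext w
      rw [hD, mem_nearAncestors, mem_nearAncestors]
      exact exists_congr fun u => and_congr_right fun hu => by
        simp only [iterate_step_eq_of_mem_extensions (hagree f hf).2 hu]
    rw [h2, ancestors_eq_of_agree (hagree f hf).2] at h1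
    have h3 := (Finset.card_le_card h1).trans (Finset.card_biUnion_le.trans
      (Finset.sum_le_sum fun w _ => card_descSet_le f (n + 1) A w))
    exact_mod_cast h3
  have hT := treeSum_nonneg h A (spanned U' f₀) (Φ := fun _ => 1) fun _ => zero_le_one
  have hDU : (D.card : ℝ) ≤ U'.card * (n + 1) := by
    exact_mod_cast card_nearAncestors_le f₀ U' n
  have hone := fun w hw => treeSum_descCount_le h hm hmc hcM n hg (w := w)
    (nearAncestors_subset f₀ U' n hw)
  have hD2 : ∑ w ∈ D, treeSum q A (spanned U' f₀) (fun f => descCount f (n + 1) A w)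
      ≤ K * treeSum q A (spanned U' f₀) fun _ => 1 := by
    refine (Finset.sum_le_sum hone).trans ?_
    rw [Finset.sum_const, nsmul_eq_mul]
    have hβ : 0 ≤ M / m * β * (n + 1) := by
      have h1 := green_mul_green_le h.bubble ∅ v
      have h2 : 0 ≤ β := le_trans (by
        rw [Matrix.mul_apply]
        exact Finset.sum_nonneg fun z _ => mul_nonneg (green_nonneg h.bubble ∅ v z)
          (green_nonneg h.bubble ∅ z v)) h1
      have h3 : 0 ≤ M := (h.c_pos v).le.trans (hcM v)
      positivity
    calc _ ≤ (U'.card * (n + 1) : ℝ) * (M / m * β * (n + 1) *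
          treeSum q A (spanned U' f₀) fun _ => 1) :=
          mul_le_mul_of_nonneg_right hDU (mul_nonneg hβ hT)
      _ = _ := by rw [hK]; ring
  calc _ ≤ ∑ f ∈ extensions A (spanned U' f₀), (∏ x ∈ A, q x (f₀ x)) *
        ∑ w ∈ D, (∏ x ∈ Aᶜ, q x (f x)) * (descCount f (n + 1) A w : ℝ) := by
        refine Finset.sum_le_sum fun f hf => ?_
        rw [if_pos ((hball f hf).2 hU), hprod f hf, mul_assoc, ← Finset.mul_sum]
        exact mul_le_mul_of_nonneg_left (mul_le_mul_of_nonneg_left (hcard f hf)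
          (Finset.prod_nonneg fun x _ => h.nonneg x _)) hP
    _ = (∏ x ∈ A, q x (f₀ x)) *
        ∑ w ∈ D, treeSum q A (spanned U' f₀) (fun f => descCount f (n + 1) A w) := by
        rw [← Finset.mul_sum, Finset.sum_comm]; rfl
    _ ≤ (∏ x ∈ A, q x (f₀ x)) * (K * treeSum q A (spanned U' f₀) fun _ => 1) :=
        mul_le_mul_of_nonneg_left hD2 hP
    _ = _ := by rw [hR]; ring

open Classical in
/-- The moments of the size of a ball in a random tree. -/
lemma sum_card_treeBall_pow_le (h : IsReversible q c β) {m M : ℝ} (hm : 0 < m)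
    (hmc : ∀ x, m ≤ c x) (hcM : ∀ x, c x ≤ M) (n : ℕ) (v : W) (k : ℕ) :
    ∑ f : W → Option W with IsAcyclic f, (∏ x, q x (f x)) * ((treeBall f v n).card : ℝ) ^ k
      ≤ k.factorial * (M / m * β * (n + 1) ^ 2) ^ k *
        ∑ f : W → Option W with IsAcyclic f, ∏ x, q x (f x) := by
  have hβ : 0 ≤ M / m * β * (n + 1) ^ 2 := by
    have h1 := green_mul_green_le h.bubble ∅ v
    have h2 : 0 ≤ β := le_trans (by
      rw [Matrix.mul_apply]
      exact Finset.sum_nonneg fun z _ => mul_nonneg (green_nonneg h.bubble ∅ v z)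
        (green_nonneg h.bubble ∅ z v)) h1
    have h3 : 0 ≤ M := (h.c_pos v).le.trans (hcM v)
    positivity
  -- A power of the cardinality counts `k`-tuples of points of the ball; the next power then weights
  -- each tuple by the size of the ball.
  have hpow : ∀ (f : W → Option W) (k : ℕ), ((treeBall f v n).card : ℝ) ^ k
      = ∑ u : Fin k → W, if Finset.univ.image u ⊆ treeBall f v n then (1 : ℝ) else 0 := by
    intro f k
    have h1 := Fintype.card_piFinset_const (treeBall f v n) k
    rw [← Nat.cast_pow, ← h1, Finset.card_eq_sum_ones, Nat.cast_sum, Nat.cast_one,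
      ← Finset.sum_filter]
    refine Finset.sum_congr ?_ fun _ _ => rfl
    ext u
    simp [Fintype.mem_piFinset, Finset.image_subset_iff]
  induction k with
  | zero => simp
  | succ k ih =>
    have h1 : ∀ f : W → Option W, (∏ x, q x (f x)) * ((treeBall f v n).card : ℝ) ^ (k + 1)
        = ∑ u : Fin k → W, (∏ x, q x (f x)) *
          (if Finset.univ.image u ⊆ treeBall f v n then ((treeBall f v n).card : ℝ) else 0) := by
      intro f
      rw [pow_succ, hpow, Finset.sum_mul, Finset.mul_sum]
      exact Finset.sum_congr rfl fun u _ => by split_ifs <;> simp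
    have h2 : ∀ f : W → Option W, (∏ x, q x (f x)) * ((treeBall f v n).card : ℝ) ^ k
        = ∑ u : Fin k → W, (∏ x, q x (f x)) *
          (if Finset.univ.image u ⊆ treeBall f v n then 1 else 0) := by
      intro f
      rw [hpow, Finset.mul_sum]
    have h3 : ∀ u : Fin k → W, ((insert v (Finset.univ.image u)).card : ℝ) ≤ k + 1 := by
      intro u
      have h4 := (Finset.card_insert_le v (Finset.univ.image u)).trans
        (Nat.add_le_add_right Finset.card_image_le 1)
      rw [Finset.card_univ, Fintype.card_fin] at h4
      exact_mod_cast h4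
    calc _ = ∑ u : Fin k → W, ∑ f : W → Option W with IsAcyclic f, (∏ x, q x (f x)) *
          (if Finset.univ.image u ⊆ treeBall f v n then ((treeBall f v n).card : ℝ) else 0) := by
          rw [Finset.sum_congr rfl fun f _ => h1 f, Finset.sum_comm]
      _ ≤ ∑ u : Fin k → W, ((k : ℝ) + 1) * (M / m * β * (n + 1) ^ 2) *
          ∑ f : W → Option W with IsAcyclic f, (∏ x, q x (f x)) *
            (if Finset.univ.image u ⊆ treeBall f v n then 1 else 0) := by
          refine Finset.sum_le_sum fun u _ => (sum_card_treeBall_le h hm hmc hcM n v _).trans ?_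
          refine mul_le_mul_of_nonneg_right (mul_le_mul_of_nonneg_right (h3 u) hβ)
            (Finset.sum_nonneg fun f _ => mul_nonneg
              (Finset.prod_nonneg fun x _ => h.nonneg x _) ?_)
          split_ifs <;> norm_num
      _ = ((k : ℝ) + 1) * (M / m * β * (n + 1) ^ 2) *
          ∑ f : W → Option W with IsAcyclic f,
            (∏ x, q x (f x)) * ((treeBall f v n).card : ℝ) ^ k := by
          rw [← Finset.mul_sum, Finset.sum_comm, Finset.sum_congr rfl fun f _ => h2 f]
      _ ≤ _ := by
          refine (mul_le_mul_of_nonneg_left ih (by positivity)).trans_eq ?_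
          rw [Nat.factorial_succ]; push_cast; ring

end ParentMap

/-! ### Spanning trees as parent maps -/

lemma ENNReal.prod_tsum_fin {E : Type*} (n : ℕ) (F : Fin n → E → ℝ≥0∞) :
    ∏ i, ∑' e, F i e = ∑' σ : Fin n → E, ∏ i, F i (σ i) := by
  induction n with
  | zero => simp
  | succ n ih =>
    rw [Fin.prod_univ_succ, ih, ← (Fin.consEquiv fun _ => E).tsum_eq, ENNReal.tsum_prod']
    simp only [Fin.consEquiv, Equiv.coe_fn_mk, Fin.prod_univ_succ, Fin.cons_zero, Fin.cons_succ]
    simp_rw [ENNReal.tsum_mul_left, ENNReal.tsum_mul_right]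

/-- Infinitely many parallel edges may join two vertices, so edge choices have to be summed by
distributing a product over infinite sums. -/
lemma ENNReal.prod_tsum {W E : Type*} [Fintype W] (F : W → E → ℝ≥0∞) :
    ∏ x, ∑' e, F x e = ∑' σ : W → E, ∏ x, F x (σ x) := by
  set φ := Fintype.equivFin W
  rw [← φ.symm.prod_comp, ENNReal.prod_tsum_fin, ← (φ.arrowCongr (Equiv.refl E)).tsum_eq]
  refine tsum_congr fun σ => ?_
  rw [← φ.symm.prod_comp fun x => F x (σ x)]
  simp [Equiv.arrowCongr]

namespace WeightedMultigraph

open ParentMap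

variable {W E : Type*} (H : WeightedMultigraph (Option W) E)

/-- A choice, for each vertex `x`, of an edge between `x` and its parent `f x`. -/
def EdgeChoice (f : W → Option W) : Type _ := {σ : W → E // ∀ x, H.ends (σ x) = s(some x, f x)}

variable {H} {f : W → Option W}

/-- Two distinct vertices with the same edge to their parents would be parents of each other. -/
lemma ends_edgeChoice_inj (hf : IsAcyclic f) (σ : H.EdgeChoice f) {x y : W}
    (h : H.ends (σ.1 x) = H.ends (σ.1 y)) : x = y := by
  rw [σ.2, σ.2, Sym2.eq_iff] at h
  rcases h with ⟨h, _⟩ | ⟨h1, h2⟩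
  · simpa using h
  · exact absurd (depth_lt hf h1.symm) (depth_lt hf h2).not_gt

lemma edgeChoice_inj (hf : IsAcyclic f) (σ : H.EdgeChoice f) : Function.Injective σ.1 :=
  fun _ _ h => ends_edgeChoice_inj hf σ (congrArg H.ends h)

lemma reachable_iterate_step (hf : IsAcyclic f) {T : Set E}
    (hT : ∀ x, ∃ e ∈ T, H.ends e = s(some x, f x)) (k : ℕ) (o : Option W) :
    (H.subgraph T).Reachable o ((step f)^[k] o) := by
  induction k generalizing o with
  | zero => exact SimpleGraph.Reachable.refl _
  | succ k ih =>
    rw [Function.iterate_succ_apply]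
    cases o with
    | none => exact ih none
    | some x =>
      obtain ⟨e, he, h⟩ := hT x
      refine SimpleGraph.Reachable.trans (SimpleGraph.Adj.reachable ?_) (ih (f x))
      exact ⟨fun h => (depth_lt hf h.symm).false, e, he, h⟩

lemma connected_of_isAcyclic (hf : IsAcyclic f) {T : Set E}
    (hT : ∀ x, ∃ e ∈ T, H.ends e = s(some x, f x)) : (H.subgraph T).Connected := by
  rw [SimpleGraph.connected_iff_exists_forall_reachable]
  refine ⟨none, fun o => ?_⟩
  cases o with
  | none => exact SimpleGraph.Reachable.refl _
  | some x =>
    obtain ⟨k, hk⟩ := hf x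
    exact (hk ▸ reachable_iterate_step hf hT k (some x)).symm

variable [Fintype W]

open Classical in
lemma isSpanningTree_image (hf : IsAcyclic f) (σ : H.EdgeChoice f) :
    H.IsSpanningTree (Finset.univ.image σ.1) := by
  refine ⟨fun e he => ?_, fun e he e' he' h => ?_, ?_⟩
  · obtain ⟨x, _, rfl⟩ := Finset.mem_image.1 he
    rw [σ.2, Sym2.mk_isDiag_iff]
    exact fun h => (depth_lt hf h.symm).false
  · obtain ⟨x, _, rfl⟩ := Finset.mem_image.1 (Finset.mem_coe.1 he)
    obtain ⟨y, _, rfl⟩ := Finset.mem_image.1 (Finset.mem_coe.1 he')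
    rw [ends_edgeChoice_inj hf σ h]
  · rw [SimpleGraph.isTree_iff_connected_and_card]
    refine ⟨connected_of_isAcyclic hf fun x => ⟨σ.1 x, by simp, σ.2 x⟩, ?_⟩
    have h1 : (H.subgraph ((Finset.univ.image σ.1 : Finset E) : Set E)).edgeSet
        = Set.range fun x => H.ends (σ.1 x) := by
      ext p
      induction p with
      | h a b =>
        rw [SimpleGraph.mem_edgeSet]
        constructor
        · rintro ⟨_, e, he, h⟩
          obtain ⟨x, _, rfl⟩ := Finset.mem_image.1 (Finset.mem_coe.1 he)
          exact ⟨x, h⟩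
        · rintro ⟨x, hx⟩
          refine ⟨?_, σ.1 x, by simp, hx⟩
          rintro rfl
          have h2 : (H.ends (σ.1 x)).IsDiag := by
            change H.ends (σ.1 x) = _ at hx
            rw [hx]; exact Sym2.mk_isDiag_iff.2 rfl
          rw [σ.2, Sym2.mk_isDiag_iff] at h2
          exact (depth_lt hf h2.symm).false
    rw [h1, Nat.card_congr (Equiv.ofInjective _ fun x y h => ends_edgeChoice_inj hf σ h).symm]
    simp

open Classical in
/-- The spanning tree formed by the chosen edges. -/
def treeOf (H : WeightedMultigraph (Option W) E)
    (p : Σ f : {f : W → Option W // IsAcyclic f}, H.EdgeChoice f.1) :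
    {T : Finset E // H.IsSpanningTree T} :=
  ⟨Finset.univ.image p.2.1, isSpanningTree_image p.1.2 p.2⟩

/-- Induction on depth recovers the choice. If the edge chosen at `x` were chosen by `σ'` at another
vertex `y`, then `y` would be the parent of `x`; being shallower, `y` has the same edge under `σ`,
which makes `x` the parent of `y` as well. -/
lemma treeOf_injective : Function.Injective H.treeOf := by
  classical
  rintro ⟨⟨f, hf⟩, σ⟩ ⟨⟨f', hf'⟩, σ'⟩ h
  have h1 : Finset.univ.image σ.1 = Finset.univ.image σ'.1 := congrArg Subtype.val h
  have h2 : ∀ d x, depth f x = d → σ'.1 x = σ.1 x := by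
    intro d
    induction d using Nat.strong_induction_on with
    | _ d ih =>
      rintro x rfl
      have hx : σ.1 x ∈ Finset.univ.image σ'.1 := h1 ▸ Finset.mem_image_of_mem _ (Finset.mem_univ x)
      obtain ⟨y, _, hy⟩ := Finset.mem_image.1 hx
      by_cases hyx : y = x
      · rw [← hy, hyx]
      · exfalso
        have h3 := congrArg H.ends hy
        rw [σ.2, σ'.2, Sym2.eq_iff] at h3
        rcases h3 with ⟨h3, _⟩ | ⟨h3, h4⟩
        · exact hyx (by simpa using h3)
        · have h5 := ih _ (depth_lt hf h3.symm) y rfl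
          have h6 := congrArg H.ends h5
          rw [σ.2, σ'.2, Sym2.congr_right] at h6
          rw [h4] at h6
          have := (depth_lt hf h6.symm).trans (depth_lt hf h3.symm)
          exact this.false
  have h3 : σ'.1 = σ.1 := funext fun x => h2 _ x rfl
  have h4 : f = f' := by
    funext x
    have := σ'.2 x
    rwa [h3, σ.2, Sym2.congr_right] at this
  subst h4
  have h5 : σ' = σ := Subtype.ext h3
  rw [h5]

/-- The parent of a vertex is the next vertex on a geodesic to the root. -/
lemma treeOf_surjective : Function.Surjective H.treeOf := by
  classical
  rintro ⟨T, hT⟩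
  obtain ⟨hdiag, hinj, htree⟩ := hT
  set S := H.subgraph (T : Set E) with hS
  have hpar : ∀ x : W, ∃ o : Option W, ∃ e ∈ T, H.ends e = s(some x, o) ∧
      S.dist o none < S.dist (some x) none := by
    intro x
    obtain ⟨p, hp⟩ := htree.connected.exists_walk_length_eq_dist (some x) none
    cases p with
    | cons h p =>
      rename_i o
      rw [SimpleGraph.Walk.length_cons] at hp
      obtain ⟨_, e, he, hends⟩ := h
      refine ⟨o, e, he, hends, ?_⟩
      rw [← hp]
      exact Nat.lt_succ_of_le (SimpleGraph.dist_le p)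
  choose f σ hσT hσ hlt using hpar
  have hf : IsAcyclic f := by
    have : ∀ d x, S.dist (some x) none = d → ∃ k, (step f)^[k] (some x) = none := by
      intro d
      induction d using Nat.strong_induction_on with
      | _ d ih =>
        rintro x rfl
        cases hx : f x with
        | none => exact ⟨1, hx⟩
        | some y =>
          obtain ⟨k, hk⟩ := ih _ (hx ▸ hlt x) y rfl
          exact ⟨k + 1, by rw [Function.iterate_succ_apply, step_some, hx, hk]⟩
    exact fun x => this _ x rfl
  refine ⟨⟨⟨f, hf⟩, ⟨σ, hσ⟩⟩, Subtype.ext ?_⟩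
  change Finset.univ.image σ = T
  have hsub : Finset.univ.image σ ⊆ T := fun e he => by
    obtain ⟨x, _, rfl⟩ := Finset.mem_image.1 he
    exact hσT x
  refine Finset.Subset.antisymm hsub fun e he => ?_
  have hconn : (H.subgraph ((Finset.univ.image σ : Finset E) : Set E)).Connected :=
    connected_of_isAcyclic hf fun x => ⟨σ x, by simp, hσ x⟩
  have hle : H.subgraph ((Finset.univ.image σ : Finset E) : Set E) ≤ S := by
    rintro a b ⟨hne, e, he, h⟩
    exact ⟨hne, e, Finset.mem_coe.2 (hsub (Finset.mem_coe.1 he)), h⟩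
  -- The chosen edges already connect everything, so minimality of a tree leaves no other adjacency,
  -- and the absence of parallel edges in `T` identifies the edges themselves.
  have hge := (SimpleGraph.isTree_iff_minimal_connected.1 htree).2 hconn hle
  obtain ⟨a, b, hab⟩ : ∃ a b, H.ends e = s(a, b) := by
    induction hp : H.ends e with
    | h a b => exact ⟨a, b, rfl⟩
  have hadj : S.Adj a b := by
    refine ⟨?_, e, he, hab⟩
    rintro rfl
    exact hdiag e he (hab ▸ Sym2.mk_isDiag_iff.2 rfl)
  obtain ⟨_, e', he', hab'⟩ := hge hadj
  have he'' : e' ∈ Finset.univ.image σ := Finset.mem_coe.1 he'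
  rwa [hinj (Finset.mem_coe.2 he) (Finset.mem_coe.2 (hsub he'')) (hab.trans hab'.symm)]

open Classical in
/-- The total conductance between a vertex `x` and `o`. -/
def edgeCond (H : WeightedMultigraph (Option W) E) (x : W) (o : Option W) : ℝ≥0∞ :=
  ∑' e, if H.ends e = s(some x, o) then (H.c e : ℝ≥0∞) else 0

lemma tsum_edgeChoice (H : WeightedMultigraph (Option W) E) (f : W → Option W) :
    ∑' σ : H.EdgeChoice f, ∏ x, (H.c (σ.1 x) : ℝ≥0∞) = ∏ x, H.edgeCond x (f x) := by
  classical
  simp only [edgeCond]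
  rw [ENNReal.prod_tsum]
  refine (tsum_subtype {σ : W → E | ∀ x, H.ends (σ x) = s(some x, f x)}
    (fun σ => ∏ x, (H.c (σ x) : ℝ≥0∞))).trans (tsum_congr fun σ => ?_)
  rw [Set.indicator_apply]
  split_ifs with h
  · exact Finset.prod_congr rfl fun x _ => (if_pos (h x)).symm
  · obtain ⟨x, hx⟩ := not_forall.1 h
    exact (Finset.prod_eq_zero (Finset.mem_univ x) (if_neg hx)).symm

open Classical in
lemma tsum_spanningTree [DecidableEq W] (H : WeightedMultigraph (Option W) E)
    (Φ : Finset E → ℝ≥0∞) :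
    ∑' T : {T : Finset E // H.IsSpanningTree T}, H.weight T * Φ T
      = ∑ f : W → Option W with IsAcyclic f, ∑' σ : H.EdgeChoice f,
        (∏ x, (H.c (σ.1 x) : ℝ≥0∞)) * Φ (Finset.univ.image σ.1) := by
  have hbij : Function.Bijective H.treeOf := ⟨treeOf_injective, treeOf_surjective⟩
  rw [← (Equiv.ofBijective _ hbij).tsum_eq, ENNReal.tsum_sigma', tsum_fintype,
    ← Finset.sum_subtype_eq_sum_filter]
  rw [Finset.subtype_univ]
  refine Finset.sum_congr rfl fun f _ => tsum_congr fun σ => ?_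
  simp only [Equiv.ofBijective_apply, treeOf, weight]
  rw [Finset.prod_image fun x _ y _ h => edgeChoice_inj f.2 σ h]

open Classical in
lemma tsum_weight [DecidableEq W] (H : WeightedMultigraph (Option W) E) :
    ∑' T : {T : Finset E // H.IsSpanningTree T}, H.weight T
      = ∑ f : W → Option W with IsAcyclic f, ∏ x, H.edgeCond x (f x) := by
  have := H.tsum_spanningTree fun _ => 1
  simp only [mul_one, tsum_edgeChoice] at this
  exact this

open Classical in
lemma tsum_weight_mul_le [DecidableEq W] (H : WeightedMultigraph (Option W) E) {Φ : Finset E → ℝ≥0∞}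
    {Ψ : (W → Option W) → ℝ≥0∞} (h : ∀ f, IsAcyclic f → ∀ T : Finset E,
      (∀ e ∈ T, ∃ x, H.ends e = s(some x, f x)) → Φ T ≤ Ψ f) :
    ∑' T : {T : Finset E // H.IsSpanningTree T}, H.weight T * Φ T
      ≤ ∑ f : W → Option W with IsAcyclic f, (∏ x, H.edgeCond x (f x)) * Ψ f := by
  rw [tsum_spanningTree]
  refine Finset.sum_le_sum fun f hf => ?_
  rw [← tsum_edgeChoice, ← ENNReal.tsum_mul_right]
  refine ENNReal.tsum_le_tsum fun σ => mul_le_mul_right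
    (h f (Finset.mem_filter.1 hf).2 _ fun e he => ?_) _
  obtain ⟨x, _, rfl⟩ := Finset.mem_image.1 he
  exact ⟨x, σ.2 x⟩

end WeightedMultigraph

/-! ### The walk on a wired network -/

namespace WeightedMultigraph

open ParentMap LoopErased

variable {V E : Type*} (G : WeightedMultigraph V E)

lemma contract_eq_some {K : Finset V} {x : K} {z : V} : contract K z = some x ↔ z = x := by
  unfold contract
  split_ifs with h
  · rw [Option.some.injEq, Subtype.ext_iff]
  · simp only [false_iff]
    rintro rfl
    exact h x.2

lemma map_contract_eq {K : Finset V} {x y : K} {p : Sym2 V} :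
    p.map (contract K) = s(some x, some y) ↔ p = s((x : V), (y : V)) := by
  induction p with
  | h a b => simp only [Sym2.map_mk, Sym2.eq_iff, contract_eq_some]

lemma some_mem_map_contract {K : Finset V} {x : K} {p : Sym2 V} :
    some x ∈ p.map (contract K) ↔ (x : V) ∈ p := by
  simp only [Sym2.mem_map, contract_eq_some, exists_eq_right]

open Classical in
lemma tsum_subtype_ite {α : Type*} (P : α → Prop) (F : α → ℝ≥0∞) :
    ∑' a : {a // P a}, F a = ∑' a, if P a then F a else 0 := by
  refine (tsum_subtype {a | P a} F).trans (tsum_congr fun a => ?_)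
  rw [Set.indicator_apply]; rfl

/-- The total conductance between two vertices. -/
def pairCond (x y : V) : ℝ≥0∞ := ∑' e : {e : E // G.ends e = s(x, y)}, (G.c e : ℝ≥0∞)

lemma pairCond_comm (x y : V) : G.pairCond x y = G.pairCond y x := by
  unfold pairCond; rw [Sym2.eq_swap]

lemma edgeCond_wired_some {K : Finset V} (x y : K) :
    (G.wired K).edgeCond x (some y) = G.pairCond x y := by
  classical
  rw [edgeCond, pairCond, tsum_subtype_ite (fun e => G.ends e = s((x : V), (y : V)))
    (fun e => (G.c e : ℝ≥0∞))]
  refine (tsum_congr fun e => ite_congr rfl (fun _ => rfl) fun _ => rfl).trans ((tsum_subtype_ite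
    (fun e => (G.ends e).map (contract K) ≠ s((none : Option K), none))
    (fun e => if (G.ends e).map (contract K) = s(some x, some y) then (G.c e : ℝ≥0∞) else 0)).trans
    (tsum_congr fun e => ?_))
  by_cases h : G.ends e = s((x : V), (y : V))
  · have h' := map_contract_eq.2 h
    rw [if_pos h, if_pos h', if_pos]
    rw [h']; simp
  · rw [if_neg h, if_neg (mt map_contract_eq.1 h), ite_self]

lemma sum_ite_eq_sym2 {α : Type*} [Fintype α] [DecidableEq α] (a : α) (p : Sym2 α) (r : ℝ≥0∞) :
    ∑ o, (if p = s(a, o) then r else 0) = if a ∈ p then r else 0 := by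
  split_ifs with h
  · obtain ⟨b, rfl⟩ := h
    simp only [Sym2.congr_right, Finset.sum_ite_eq, Finset.mem_univ, if_true]
  · refine Finset.sum_eq_zero fun o _ => if_neg ?_
    rintro rfl
    exact h (Sym2.mem_mk_left a o)

/-- An edge at `x` is counted for exactly one `o`, its other end (`x` itself for a loop), and the
deleted boundary loops do not meet `K`. So wiring preserves vertex conductances on `K`. -/
lemma sum_edgeCond_wired {K : Finset V} (x : K) :
    ∑ o, (G.wired K).edgeCond x o = G.vertexCond x := by
  classical
  simp only [edgeCond]
  rw [← Summable.tsum_finsetSum fun _ _ => ENNReal.summable, vertexCond,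
    tsum_subtype_ite (fun e => (x : V) ∈ G.ends e) (fun e => (G.c e : ℝ≥0∞))]
  simp_rw [sum_ite_eq_sym2]
  refine (tsum_congr fun e => ite_congr rfl (fun _ => rfl) fun _ => rfl).trans ((tsum_subtype_ite
    (fun e => (G.ends e).map (contract K) ≠ s((none : Option K), none))
    (fun e => if some x ∈ (G.ends e).map (contract K) then (G.c e : ℝ≥0∞) else 0)).trans
    (tsum_congr fun e => ?_))
  simp only [some_mem_map_contract]
  by_cases h : (x : V) ∈ G.ends e
  · rw [if_pos h, if_pos h, if_pos]
    intro h'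
    have := some_mem_map_contract.2 h
    rw [h'] at this
    simp at this
  · rw [if_neg h, if_neg h, ite_self]

/-- The transition probabilities of the walk on a wired network. -/
def wiredStep (K : Finset V) (x : K) (o : Option K) : ℝ :=
  ((G.wired K).edgeCond x o / G.vertexCond x).toReal

variable {G}

lemma edgeCond_wired_le {K : Finset V} (x : K) (o : Option K) :
    (G.wired K).edgeCond x o ≤ G.vertexCond x := by
  classical
  rw [← sum_edgeCond_wired]
  exact Finset.single_le_sum (f := fun o => (G.wired K).edgeCond x o) (fun _ _ => zero_le)
    (Finset.mem_univ o)

lemma stepProb_eq (x y : V) : G.stepProb x y = G.pairCond x y / G.vertexCond x := rfl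

lemma edgeCond_wired_eq (h0 : ∀ v, G.vertexCond v ≠ 0) (htop : ∀ v, G.vertexCond v ≠ ∞)
    {K : Finset V} (x : K) (o : Option K) : (G.wired K).edgeCond x o
      = ENNReal.ofReal ((G.vertexCond x).toReal * G.wiredStep K x o) := by
  rw [wiredStep, ← ENNReal.toReal_mul, ENNReal.mul_div_cancel (h0 x) (htop x),
    ENNReal.ofReal_toReal (ne_top_of_le_ne_top (htop x) (edgeCond_wired_le x o))]

open Classical in
-- Killing the walk when it leaves `K` only loses trajectories, so the bubble bound of `G` holds for
-- every `K` at once.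
lemma ofReal_transMatrix_pow_le {K : Finset V} (n : ℕ) (x y : K) :
    ENNReal.ofReal ((transMatrix (G.wiredStep K) ^ n) x y) ≤ G.transProb n x y := by
  have hnn : ∀ x y : K, 0 ≤ transMatrix (G.wiredStep K) x y := fun x y => ENNReal.toReal_nonneg
  induction n generalizing x with
  | zero =>
    simp only [pow_zero, Matrix.one_apply, transProb, Subtype.ext_iff]
    split_ifs <;> simp
  | succ n ih =>
    rw [pow_succ', Matrix.mul_apply, ENNReal.ofReal_sum_of_nonneg fun k _ =>
      mul_nonneg (hnn x k) (pow_apply_nonneg hnn n k y), transProb]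
    refine le_trans (Finset.sum_le_sum fun k _ => ?_)
      ((tsum_fintype (L := .unconditional K) _).ge.trans
      (ENNReal.tsum_comp_le_tsum_of_injective Subtype.val_injective
        fun w : V => G.stepProb x w * G.transProb n w y))
    rw [ENNReal.ofReal_mul (hnn x k)]
    refine mul_le_mul' ?_ (ih k)
    rw [transMatrix, wiredStep, edgeCond_wired_some, ← stepProb_eq]
    exact ENNReal.ofReal_toReal_le

open Classical in
lemma hasBubble_wired (hb : G.bubbleNorm ≠ ∞) (K : Finset V) :
    HasBubble (transMatrix (G.wiredStep K)) G.bubbleNorm.toReal := by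
  have hnn : ∀ x y : K, 0 ≤ transMatrix (G.wiredStep K) x y := fun x y => ENNReal.toReal_nonneg
  have hn : ∀ (x y : K) (n : ℕ), 0 ≤ ((n : ℝ) + 1) * (transMatrix (G.wiredStep K) ^ n) x y :=
    fun x y n => mul_nonneg (by positivity) (pow_apply_nonneg hnn n x y)
  have hle : ∀ x y : K, ∑' n : ℕ,
      ENNReal.ofReal (((n : ℝ) + 1) * (transMatrix (G.wiredStep K) ^ n) x y) ≤ G.bubbleNorm := by
    intro x y
    refine ENNReal.tsum_le_tsum fun n => ?_
    rw [ENNReal.ofReal_mul (by positivity)]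
    refine mul_le_mul' ?_ ((ofReal_transMatrix_pow_le n x y).trans
      (le_iSup₂ (f := fun u v => G.transProb n u v) (x : V) (y : V)))
    rw [ENNReal.ofReal_add (by positivity) zero_le_one]
    simp
  have hs : ∀ x y : K, Summable fun n : ℕ =>
      ((n : ℝ) + 1) * (transMatrix (G.wiredStep K) ^ n) x y := fun x y =>
    (ENNReal.summable_toReal (ne_top_of_le_ne_top hb (hle x y))).congr fun n =>
      ENNReal.toReal_ofReal (hn x y n)
  refine ⟨hnn, hs, fun x => ?_⟩
  rw [← ENNReal.ofReal_le_iff_le_toReal hb, ENNReal.ofReal_tsum_of_nonneg (hn x x) (hs x x)]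
  exact hle x x

open Classical in
lemma isReversible_wired (h0 : ∀ v, G.vertexCond v ≠ 0) (htop : ∀ v, G.vertexCond v ≠ ∞)
    (hb : G.bubbleNorm ≠ ∞) (K : Finset V) :
    IsReversible (G.wiredStep K) (fun x => (G.vertexCond x).toReal) G.bubbleNorm.toReal := by
  refine ⟨fun _ _ => ENNReal.toReal_nonneg, fun x => ?_,
    fun x => ENNReal.toReal_pos (h0 x) (htop x), fun x y => ?_, hasBubble_wired hb K⟩
  · simp only [wiredStep]
    rw [← ENNReal.toReal_sum fun o _ => ENNReal.div_ne_top
      (ne_top_of_le_ne_top (htop x) (edgeCond_wired_le x o)) (h0 x)]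
    simp_rw [div_eq_mul_inv]
    rw [← Finset.sum_mul, sum_edgeCond_wired, ENNReal.mul_inv_cancel (h0 x) (htop x),
      ENNReal.toReal_one]
  · simp only [wiredStep]
    rw [← ENNReal.toReal_mul, ← ENNReal.toReal_mul, ENNReal.mul_div_cancel (h0 x) (htop x),
      ENNReal.mul_div_cancel (h0 y) (htop y), edgeCond_wired_some, edgeCond_wired_some,
      pairCond_comm]

/-- Balls for edge sets that are contained in a tree of a wired network and avoid the boundary. -/
lemma exists_mem_treeBall {K : Finset V} {f : K → Option K} {ω : Set E}
    (hω : ∀ e ∈ ω, (∀ x ∈ G.ends e, x ∈ K) ∧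
      ∃ z, (G.ends e).map (contract K) = s(some z, f z))
    {v : V} (hv : v ∈ K) {u : V} (p : (G.subgraph ω).Walk u v) :
    ∃ hu : u ∈ K, ⟨u, hu⟩ ∈ treeBall f ⟨v, hv⟩ p.length := by
  induction p with
  | nil => exact ⟨hv, mem_treeBall.2 ⟨0, 0, ⟨_, hv⟩, le_rfl, rfl, rfl⟩⟩
  | @cons u u' v h p ih =>
    obtain ⟨hu', hmem⟩ := ih hv
    obtain ⟨i, j, w, hij, hi, hj⟩ := mem_treeBall.1 hmem
    rw [SimpleGraph.Walk.length_cons]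
    obtain ⟨_, e, he, hends⟩ := h
    obtain ⟨hK, z, hz⟩ := hω e he
    have hu : u ∈ K := hK u (hends ▸ Sym2.mem_mk_left u u')
    refine ⟨hu, mem_treeBall.2 ?_⟩
    have h1 := (map_contract_eq (x := ⟨u, hu⟩) (y := ⟨u', hu'⟩)).2 hends
    rw [hz, Sym2.eq_iff] at h1
    -- Either `u` is a child of `u'`, one generation further below `w`, or `u` is its parent. In the
    -- latter case `u` is one generation closer to `w`, unless `u' = w`, when `u` replaces `w` as
    -- the common ancestor.
    rcases h1 with ⟨h1, h2⟩ | ⟨h1, h2⟩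
    · refine ⟨i, j + 1, w, by omega, hi, ?_⟩
      rw [Option.some.injEq] at h1
      rw [Function.iterate_succ_apply, step_some, ← h1, h2, hj]
    · rw [Option.some.injEq] at h1
      subst h1
      cases j with
      | zero =>
        rw [Function.iterate_zero, id, Option.some.injEq] at hj
        subst hj
        refine ⟨i + 1, 0, ⟨u, hu⟩, by omega, ?_, rfl⟩
        rw [Function.iterate_succ_apply', hi, step_some, h2]
      | succ j =>
        refine ⟨i, j, w, by omega, hi, ?_⟩
        rw [Function.iterate_succ_apply, step_some, h2] at hj
        exact hj

lemma treeBall_mono {W : Type*} [Fintype W] {f : W → Option W} {v : W} {m n : ℕ} (h : m ≤ n) :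
    treeBall f v m ⊆ treeBall f v n := fun u hu => by
  classical
  obtain ⟨i, j, w, hij, hi, hj⟩ := mem_treeBall.1 hu
  exact mem_treeBall.2 ⟨i, j, w, hij.trans h, hi, hj⟩

lemma ncard_intrinsicBall_le {K : Finset V} {f : K → Option K} {ω : Set E}
    (hω : ∀ e ∈ ω, (∀ x ∈ G.ends e, x ∈ K) ∧
      ∃ z, (G.ends e).map (contract K) = s(some z, f z))
    {v : V} (hv : v ∈ K) (n : ℕ) :
    (G.intrinsicBall ω v n).ncard ≤ (treeBall f ⟨v, hv⟩ n).card := by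
  classical
  have hsub : G.intrinsicBall ω v n ⊆ ((treeBall f ⟨v, hv⟩ n).image Subtype.val : Finset V) := by
    intro u hu
    have hu : (G.subgraph ω).edist v u ≤ n := hu
    have hr : (G.subgraph ω).edist v u ≠ ⊤ := ne_top_of_le_ne_top (ENat.natCast_ne_top n) hu
    obtain ⟨p, hp⟩ := SimpleGraph.exists_walk_of_edist_ne_top hr
    obtain ⟨huK, hmem⟩ := exists_mem_treeBall hω hv p.reverse
    rw [← hp, Nat.cast_le] at hu
    rw [SimpleGraph.Walk.length_reverse] at hmem
    exact Finset.mem_coe.2 (Finset.mem_image.2 ⟨_, treeBall_mono hu hmem, rfl⟩)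
  refine (Set.ncard_le_ncard hsub (Finset.finite_toSet _)).trans ?_
  rw [Set.ncard_coe_finset]
  exact Finset.card_image_le

/-- The edges of a wired network. -/
abbrev WiredEdge (G : WeightedMultigraph V E) (K : Finset V) : Type _ :=
  {e : E // (G.ends e).map (contract K) ≠ s((none : Option K), none)}

/-- The edges of `G` that form a given set of edges of a wired network. -/
def origEdges (G : WeightedMultigraph V E) (K : Finset V)
    (ω : Set (G.WiredEdge K)) : Set E :=
  Subtype.val '' ω

/-- The moments of the size of a ball in the uniform spanning tree of a wired network. -/
lemma tsum_weight_mul_ncard_pow_le (h0 : ∀ v, G.vertexCond v ≠ 0)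
    (htop : ∀ v, G.vertexCond v ≠ ∞) (hb : G.bubbleNorm ≠ ∞) {m M : ℝ} (hm : 0 < m)
    (hmc : ∀ x, m ≤ (G.vertexCond x).toReal) (hcM : ∀ x, (G.vertexCond x).toReal ≤ M)
    {K : Finset V} {v : V} (hv : v ∈ K) {A : Finset E} (hA : ∀ e ∈ A, ∀ x ∈ G.ends e, x ∈ K)
    (n k : ℕ) :
    ∑' T : {T : Finset (G.WiredEdge K) // (G.wired K).IsSpanningTree T}, (G.wired K).weight T *
        ((G.intrinsicBall (G.origEdges K (T.1 : Set (G.WiredEdge K)) ∩ A) v n).ncard : ℝ≥0∞) ^ k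
      ≤ ENNReal.ofReal (k.factorial * (M / m * G.bubbleNorm.toReal * (n + 1) ^ 2) ^ k) *
        ∑' T : {T : Finset (G.WiredEdge K) // (G.wired K).IsSpanningTree T},
          (G.wired K).weight T := by
  classical
  have hrev := isReversible_wired h0 htop hb K
  have hmain := sum_card_treeBall_pow_le hrev hm (fun x => hmc x) (fun x => hcM x) n
    (⟨v, hv⟩ : K) k
  have hΦ : ∀ f, IsAcyclic f → ∀ T : Finset (G.WiredEdge K),
      (∀ e ∈ T, ∃ z, (G.wired K).ends e = s(some z, f z)) →
      ((G.intrinsicBall (G.origEdges K (T : Set (G.WiredEdge K)) ∩ A) v n).ncard : ℝ≥0∞) ^ k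
        ≤ ((treeBall f (⟨v, hv⟩ : K) n).card : ℝ≥0∞) ^ k := by
    intro f _ T hT
    refine pow_le_pow_left' (Nat.cast_le.2 (ncard_intrinsicBall_le ?_ hv n)) k
    rintro e ⟨⟨e', he', rfl⟩, heA⟩
    exact ⟨hA _ heA, hT e' (Finset.mem_coe.1 he')⟩
  refine ((G.wired K).tsum_weight_mul_le (Φ := fun T =>
    ((G.intrinsicBall (G.origEdges K (T : Set (G.WiredEdge K)) ∩ A) v n).ncard : ℝ≥0∞) ^ k)
    hΦ).trans ?_
  rw [tsum_weight]
  -- Each vertex chooses exactly one parent, so conductance weights and transition weights differ by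
  -- the factor `∏ c(x)`, common to all trees.
  have hprod : ∀ f : K → Option K, ∏ x, (G.wired K).edgeCond x (f x)
      = ENNReal.ofReal (∏ x : K, (G.vertexCond x).toReal) *
        ENNReal.ofReal (∏ x, G.wiredStep K x (f x)) := by
    intro f
    rw [← ENNReal.ofReal_mul (Finset.prod_nonneg fun x _ => ENNReal.toReal_nonneg),
      ← Finset.prod_mul_distrib, ENNReal.ofReal_prod_of_nonneg fun x _ =>
        mul_nonneg ENNReal.toReal_nonneg (hrev.nonneg x _)]
    exact Finset.prod_congr rfl fun x _ => edgeCond_wired_eq h0 htop x (f x)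
  have hqn : ∀ f : K → Option K, 0 ≤ ∏ x, G.wiredStep K x (f x) := fun f =>
    Finset.prod_nonneg fun x _ => hrev.nonneg x _
  have hM0 : 0 ≤ M := ENNReal.toReal_nonneg.trans (hcM v)
  simp only [hprod, mul_assoc]
  rw [← Finset.mul_sum, ← Finset.mul_sum, mul_left_comm]
  refine mul_le_mul_right ?_ _
  rw [← ENNReal.ofReal_sum_of_nonneg fun f _ => hqn f, ← ENNReal.ofReal_mul (by positivity)]
  have hl : ∀ f : K → Option K, ENNReal.ofReal (∏ x, G.wiredStep K x (f x)) *
      ((treeBall f (⟨v, hv⟩ : K) n).card : ℝ≥0∞) ^ k = ENNReal.ofReal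
        ((∏ x, G.wiredStep K x (f x)) * ((treeBall f (⟨v, hv⟩ : K) n).card : ℝ) ^ k) := by
    intro f
    rw [ENNReal.ofReal_mul (hqn f), ENNReal.ofReal_pow (Nat.cast_nonneg _), ENNReal.ofReal_natCast]
  simp only [hl]
  rw [← ENNReal.ofReal_sum_of_nonneg fun f _ => mul_nonneg (hqn f) (by positivity)]
  refine ENNReal.ofReal_le_ofReal (hmain.trans_eq ?_)
  ring

end WeightedMultigraph

/-! ### Random sets and their finite-dimensional distributions -/

section RandomSets

variable {E : Type*}

/-- The sets that contain `S` and avoid `B`. -/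
def cylinderSet (S B : Finset E) : Set (Set E) := {ω | (∀ e ∈ S, e ∈ ω) ∧ ∀ e ∈ B, e ∉ ω}

lemma measurableSet_cylinderSet (S B : Finset E) : MeasurableSet (cylinderSet S B) := by
  refine MeasurableSet.inter ?_ ?_
  · have : {ω : Set E | ∀ e ∈ S, e ∈ ω} = ⋂ e ∈ S, {ω | e ∈ ω} := by ext; simp
    change MeasurableSet {ω : Set E | ∀ e ∈ S, e ∈ ω}
    rw [this]
    exact S.measurableSet_biInter fun e _ => measurableSet_setOfPred.2 (measurable_set_mem e)
  · have : {ω : Set E | ∀ e ∈ B, e ∉ ω} = ⋂ e ∈ B, {ω | e ∈ ω}ᶜ := by ext; simp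
    change MeasurableSet {ω : Set E | ∀ e ∈ B, e ∉ ω}
    rw [this]
    exact B.measurableSet_biInter fun e _ =>
      (measurableSet_setOfPred.2 (measurable_set_mem e)).compl

lemma cylinderSet_insert [DecidableEq E] (S B : Finset E) (e : E) :
    cylinderSet S (insert e B) = cylinderSet S B \ cylinderSet (insert e S) B := by
  ext ω
  simp only [cylinderSet, Finset.mem_insert, forall_eq_or_imp, Set.mem_sdiff, Set.mem_ofPred_eq]
  tauto

/-- Inclusion–exclusion, one forbidden edge at a time: inclusion probabilities determine all
cylinder probabilities. -/
lemma tendsto_cylinderSet {ν : ℕ → Measure (Set E)} {P : Measure (Set E)}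
    [∀ m, IsFiniteMeasure (ν m)] [IsFiniteMeasure P]
    (h : ∀ S : Finset E, Tendsto (fun m => ν m (cylinderSet S ∅)) atTop (𝓝 (P (cylinderSet S ∅))))
    (S B : Finset E) :
    Tendsto (fun m => ν m (cylinderSet S B)) atTop (𝓝 (P (cylinderSet S B))) := by
  classical
  induction B using Finset.induction_on generalizing S with
  | empty => exact h S
  | insert e B _ ih =>
    have hsub : cylinderSet (insert e S) B ⊆ cylinderSet S B := fun ω hω =>
      ⟨fun x hx => hω.1 x (Finset.mem_insert_of_mem hx), hω.2⟩
    simp only [cylinderSet_insert]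
    rw [measure_sdiff hsub (measurableSet_cylinderSet _ _).nullMeasurableSet (measure_ne_top _ _)]
    simp only [fun m => measure_sdiff (μ := ν m) hsub
      (measurableSet_cylinderSet (insert e S) B).nullMeasurableSet (measure_ne_top _ _)]
    exact ENNReal.Tendsto.sub (ih S) (ih _) (Or.inl (measure_ne_top _ _))

lemma eq_sum_cylinderSet [DecidableEq E] (A : Finset E) (g : Set E → ℝ≥0∞) (ω : Set E) :
    g (ω ∩ A) = ∑ S ∈ A.powerset, (cylinderSet S (A \ S)).indicator (fun _ => g S) ω := by
  classical
  have hS : ((A.filter (· ∈ ω) : Finset E) : Set E) = ω ∩ A := by ext; simp [and_comm]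
  rw [Finset.sum_eq_single (A.filter (· ∈ ω))]
  · rw [Set.indicator_of_mem, hS]
    refine ⟨fun e he => (Finset.mem_filter.1 he).2, fun e he heω => ?_⟩
    rw [Finset.mem_sdiff, Finset.mem_filter] at he
    exact he.2 ⟨he.1, heω⟩
  · intro S hSA hne
    refine Set.indicator_of_notMem (fun hω => hne ?_) _
    ext e
    have h1 := hω.1 e
    have h2 := hω.2 e
    have h3 : e ∈ S → e ∈ A := fun h => Finset.mem_powerset.1 hSA h
    simp only [Finset.mem_sdiff, Finset.mem_filter] at *
    tauto
  · intro h
    exact absurd (Finset.mem_powerset.2 (Finset.filter_subset _ _)) h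

lemma measurable_inter_finset (A : Finset E) (g : Set E → ℝ≥0∞) :
    Measurable fun ω : Set E => g (ω ∩ A) := by
  classical
  simp_rw [eq_sum_cylinderSet A g]
  exact Finset.measurable_sum _ fun S _ =>
    measurable_const.indicator (measurableSet_cylinderSet _ _)

lemma lintegral_inter_finset [DecidableEq E] (P : Measure (Set E)) (A : Finset E)
    (g : Set E → ℝ≥0∞) :
    ∫⁻ ω, g (ω ∩ A) ∂P = ∑ S ∈ A.powerset, g S * P (cylinderSet S (A \ S)) := by
  simp_rw [eq_sum_cylinderSet A g]
  rw [lintegral_finsetSum _ fun S _ =>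
    measurable_const.indicator (measurableSet_cylinderSet _ _)]
  exact Finset.sum_congr rfl fun S _ =>
    lintegral_indicator_const (measurableSet_cylinderSet _ _) _

/-- A bound for the mean of a function of finitely many coordinates passes to weak limits. -/
lemma lintegral_inter_finset_le_of_tendsto {ν : ℕ → Measure (Set E)} {P : Measure (Set E)}
    [∀ m, IsFiniteMeasure (ν m)] [IsFiniteMeasure P]
    (h : ∀ S : Finset E, Tendsto (fun m => ν m (cylinderSet S ∅)) atTop (𝓝 (P (cylinderSet S ∅))))
    (A : Finset E) {g : Set E → ℝ≥0∞} (hg : ∀ ω, g (ω ∩ A) ≠ ∞) {C : ℝ≥0∞}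
    (hC : ∀ᶠ m in atTop, ∫⁻ ω, g (ω ∩ A) ∂(ν m) ≤ C) : ∫⁻ ω, g (ω ∩ A) ∂P ≤ C := by
  classical
  refine le_of_tendsto ?_ hC
  simp_rw [lintegral_inter_finset]
  refine tendsto_finsetSum _ fun S hS => ENNReal.Tendsto.const_mul
    (tendsto_cylinderSet h S (A \ S)) (Or.inr ?_)
  have := hg S
  rwa [Set.inter_eq_left.2 (Finset.coe_subset.2 (Finset.mem_powerset.1 hS))] at this

end RandomSets

namespace WeightedMultigraph

variable {V E : Type*} {G : WeightedMultigraph V E}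

/-! ### Uniform spanning trees of wired networks -/

lemma lintegral_ust {V' E' : Type*} (H : WeightedMultigraph V' E') {g : Set E' → ℝ≥0∞}
    (hg : Measurable g) : ∫⁻ ω, g ω ∂H.ust
      = (∑' T : {T : Finset E' // H.IsSpanningTree T}, H.weight T)⁻¹ *
        ∑' T : {T : Finset E' // H.IsSpanningTree T}, H.weight T * g (T : Finset E') := by
  rw [ust, lintegral_smul_measure, lintegral_sum_measure, smul_eq_mul]
  congr 1
  refine tsum_congr fun T => ?_
  rw [lintegral_smul_measure, lintegral_dirac' _ hg, smul_eq_mul]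

/-- `a⁻¹ * a ≤ 1` holds even for `a = 0` and `a = ∞`, so the normalising constant need not be
examined. -/
instance {V' E' : Type*} (H : WeightedMultigraph V' E') : IsFiniteMeasure H.ust := by
  constructor
  rw [← lintegral_one, lintegral_ust H measurable_const]
  simp only [mul_one]
  exact (ENNReal.inv_mul_le_one _).trans_lt ENNReal.one_lt_top

lemma measurable_origEdges (K : Finset V) : Measurable (G.origEdges K) := by
  refine measurable_set_iff.2 fun e => ?_
  by_cases he : (G.ends e).map (contract K) ≠ s((none : Option K), none)
  · have : (fun ω : Set (G.WiredEdge K) => e ∈ G.origEdges K ω)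
        = fun ω => (⟨e, he⟩ : G.WiredEdge K) ∈ ω := by
      funext ω
      simp [origEdges, he]
    rw [this]
    exact measurable_set_mem _
  · have : (fun ω : Set (G.WiredEdge K) => e ∈ G.origEdges K ω) = fun _ => False := by
      funext ω
      simp only [origEdges, Set.mem_image, eq_iff_iff, iff_false]
      rintro ⟨e', _, rfl⟩
      exact he e'.2
    rw [this]
    exact measurable_const

lemma intrinsicBall_mono {ω ω' : Set E} (h : ω ⊆ ω') (v : V) (n : ℕ) :
    G.intrinsicBall ω v n ⊆ G.intrinsicBall ω' v n := fun u hu => by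
  have hle : G.subgraph ω ≤ G.subgraph ω' := by
    rintro a b ⟨hne, e, he, hab⟩
    exact ⟨hne, e, h he, hab⟩
  exact (SimpleGraph.edist_anti hle).trans hu

lemma exists_finset_of_walk {ω : Set E} {u v : V} (p : (G.subgraph ω).Walk u v) :
    ∃ A : Finset E, ∃ q : (G.subgraph (ω ∩ A)).Walk u v, q.length = p.length := by
  classical
  induction p with
  | nil => exact ⟨∅, .nil, rfl⟩
  | @cons u u' v h p ih =>
    obtain ⟨A, q, hq⟩ := ih
    rw [SimpleGraph.Walk.length_cons]
    obtain ⟨hne, e, he, hends⟩ := h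
    have hle : G.subgraph (ω ∩ A) ≤ G.subgraph (ω ∩ (insert e A : Finset E)) := by
      rintro a b ⟨hne, e', he', hab⟩
      exact ⟨hne, e', ⟨he'.1, Finset.mem_coe.2 (Finset.mem_insert_of_mem he'.2)⟩, hab⟩
    have hadj : (G.subgraph (ω ∩ (insert e A : Finset E))).Adj u u' :=
      ⟨hne, e, ⟨he, Finset.mem_coe.2 (Finset.mem_insert_self e A)⟩, hends⟩
    exact ⟨insert e A, .cons hadj (q.mapLe hle), by simp [hq]⟩

lemma exists_finset_mem_intrinsicBall {ω : Set E} {u v : V} {n : ℕ}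
    (hu : u ∈ G.intrinsicBall ω v n) : ∃ A : Finset E, u ∈ G.intrinsicBall (ω ∩ A) v n := by
  have hu : (G.subgraph ω).edist v u ≤ n := hu
  obtain ⟨p, hp⟩ := SimpleGraph.exists_walk_of_edist_ne_top
    (ne_top_of_le_ne_top (ENat.natCast_ne_top n) hu)
  obtain ⟨A, q, hq⟩ := exists_finset_of_walk p
  refine ⟨A, q.edist_le.trans ?_⟩
  rwa [hq, hp]

lemma finite_intrinsicBall_inter (ω : Set E) (A : Finset E) (v : V) (n : ℕ) :
    (G.intrinsicBall (ω ∩ A) v n).Finite := by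
  classical
  have hfin : (insert v (⋃ e ∈ A, {x | x ∈ G.ends e})).Finite := by
    refine (Set.Finite.biUnion A.finite_toSet fun e _ => ?_).insert v
    induction hp : G.ends e with
    | h a b =>
      refine (Set.toFinite {a, b}).subset fun x hx => ?_
      simpa using hx
  refine hfin.subset fun u hu => ?_
  have hu : (G.subgraph (ω ∩ A)).edist v u ≤ n := hu
  obtain ⟨p, -⟩ := SimpleGraph.exists_walk_of_edist_ne_top
    (ne_top_of_le_ne_top (ENat.natCast_ne_top n) hu)
  cases p.reverse with
  | nil => exact Set.mem_insert _ _
  | @cons _ w _ h q =>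
    obtain ⟨_, e, he, hends⟩ := h
    refine Set.mem_insert_of_mem _ (Set.mem_biUnion he.2 ?_)
    change u ∈ G.ends e
    rw [hends]; exact Sym2.mem_mk_left _ _

/-- The moments of balls in the wired uniform spanning forest that use only the edges in a finite
set. -/
lemma lintegral_ncard_inter_pow_le (h0 : ∀ v, G.vertexCond v ≠ 0)
    (htop : ∀ v, G.vertexCond v ≠ ∞) (hb : G.bubbleNorm ≠ ∞) {m M : ℝ} (hm : 0 < m)
    (hmc : ∀ x, m ≤ (G.vertexCond x).toReal) (hcM : ∀ x, (G.vertexCond x).toReal ≤ M)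
    {Ω : Type*} [MeasurableSpace Ω] {μ : Measure Ω} [IsProbabilityMeasure μ] {F : Ω → Set E}
    (hF : G.IsWUSF μ F) (v : V) (n k : ℕ) (A : Finset E) :
    ∫⁻ x, ((G.intrinsicBall (F x ∩ A) v n).ncard : ℝ≥0∞) ^ k ∂μ
      ≤ ENNReal.ofReal (k.factorial * (M / m * G.bubbleNorm.toReal * (n + 1) ^ 2) ^ k) := by
  classical
  obtain ⟨hFm, K, hK, hlim⟩ := hF
  set g : Set E → ℝ≥0∞ := fun ω => ((G.intrinsicBall ω v n).ncard : ℝ≥0∞) ^ k with hg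
  have hgm : Measurable fun ω : Set E => g (ω ∩ A) := measurable_inter_finset A g
  have h1 : ∫⁻ x, ((G.intrinsicBall (F x ∩ A) v n).ncard : ℝ≥0∞) ^ k ∂μ
      = ∫⁻ ω, g (ω ∩ A) ∂(μ.map F) := (lintegral_map hgm hFm).symm
  rw [h1]
  have hfin : IsProbabilityMeasure (μ.map F) := Measure.isProbabilityMeasure_map hFm.aemeasurable
  refine lintegral_inter_finset_le_of_tendsto
    (ν := fun j => (G.wired (K j)).ust.map (G.origEdges (K j))) (fun S => ?_) A
    (fun ω => ENNReal.pow_ne_top (ENNReal.natCast_ne_top _)) ?_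
  · have h2 : ∀ ω : Set E, ω ∈ cylinderSet S ∅ ↔ (S : Set E) ⊆ ω := fun ω => by
      simp [cylinderSet, Set.subset_def]
    simp_rw [Measure.map_apply (measurable_origEdges _) (measurableSet_cylinderSet S ∅)]
    rw [Measure.map_apply hFm (measurableSet_cylinderSet S ∅)]
    have h3 := hlim S
    have h4 : F ⁻¹' cylinderSet S ∅ = {x | (S : Set E) ⊆ F x} := by ext x; exact h2 _
    have h5 : ∀ j, G.origEdges (K j) ⁻¹' cylinderSet S ∅
        = {ω | (S : Set E) ⊆ Subtype.val '' ω} := fun j => by ext x; exact h2 _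
    simp_rw [h5]
    rw [h4]
    exact h3
  · have hex : ∀ w, ∀ᶠ j in atTop, w ∈ K j := fun w => by
      obtain ⟨j, hj⟩ := hK.2 w
      exact eventually_atTop.2 ⟨j, fun i hi => hK.1 hi hj⟩
    -- Eventually no edge of `A` touches the boundary, so paths in `A` avoid the root and are
    -- controlled by `treeBall`, where the root is removed.
    have hA : ∀ᶠ j in atTop, ∀ e ∈ A, ∀ x ∈ G.ends e, x ∈ K j := by
      rw [Filter.eventually_all_finset]
      intro e _
      induction hp : G.ends e with
      | h a b =>
        filter_upwards [hex a, hex b] with j ha hb x hx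
        rcases Sym2.mem_iff.1 hx with rfl | rfl
        exacts [ha, hb]
    filter_upwards [hex v, hA] with j hv hA
    rw [lintegral_map hgm (measurable_origEdges _),
      lintegral_ust _ (g := fun ω => g (G.origEdges (K j) ω ∩ A))
        (hgm.comp (measurable_origEdges _))]
    refine (mul_le_mul_right
      (tsum_weight_mul_ncard_pow_le h0 htop hb hm hmc hcM hv hA n k) _).trans ?_
    rw [mul_left_comm]
    exact mul_le_of_le_one_right' (ENNReal.inv_mul_le_one _)

end WeightedMultigraph

/-! ### Moments and exponential moments -/

lemma integrable_pow_and_integral_le {Ω : Type*} [MeasurableSpace Ω] {μ : Measure Ω} {N : Ω → ℕ}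
    {L : Ω → ℝ≥0∞} (hL : Measurable L) (hN : ∀ᵐ x ∂μ, (N x : ℝ≥0∞) = L x) {k : ℕ} {C : ℝ}
    (hC0 : 0 ≤ C) (hC : ∫⁻ x, L x ^ k ∂μ ≤ ENNReal.ofReal C) :
    Integrable (fun x => (N x : ℝ) ^ k) μ ∧ ∫ x, (N x : ℝ) ^ k ∂μ ≤ C := by
  have hae : (fun x => (N x : ℝ) ^ k) =ᵐ[μ] fun x => (L x ^ k).toReal := by
    filter_upwards [hN] with x hx
    rw [← hx]; simp
  have hint : Integrable (fun x => (L x ^ k).toReal) μ :=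
    integrable_toReal_of_lintegral_ne_top (hL.pow_const k).aemeasurable
      (ne_top_of_le_ne_top ENNReal.ofReal_ne_top hC)
  refine ⟨hint.congr hae.symm, ?_⟩
  rw [integral_congr_ae hae, integral_toReal (hL.pow_const k).aemeasurable]
  · exact ENNReal.toReal_le_of_le_ofReal hC0 hC
  · filter_upwards [hN] with x hx
    rw [← hx]
    exact ENNReal.pow_lt_top (ENNReal.natCast_lt_top _)

/-- If the `k`-th moment is at most `k! a ^ k` for every `k`, then the exponential moments are
bounded by those of an exponential random variable of mean `a`. -/
lemma integrable_exp_and_integral_le {Ω : Type*} [MeasurableSpace Ω] {μ : Measure Ω} {N : Ω → ℕ}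
    (hNm : AEMeasurable (fun x => (N x : ℝ)) μ) {a s t : ℝ} (ha : 0 ≤ a) (hs : 0 ≤ s)
    (hst : s * a ≤ t) (ht : t < 1)
    (h : ∀ k : ℕ, Integrable (fun x => (N x : ℝ) ^ k) μ ∧
      ∫ x, (N x : ℝ) ^ k ∂μ ≤ k.factorial * a ^ k) :
    Integrable (fun x => Real.exp (s * N x)) μ ∧ ∫ x, Real.exp (s * N x) ∂μ ≤ 1 / (1 - t) := by
  have h0 : 0 ≤ s * a := mul_nonneg hs ha
  have ht0 : 0 ≤ t := h0.trans hst
  have hm : AEStronglyMeasurable (fun x => Real.exp (s * N x)) μ :=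
    (Real.measurable_exp.comp_aemeasurable (hNm.const_mul s)).aestronglyMeasurable
  have hle : ∫⁻ x, ENNReal.ofReal (Real.exp (s * N x)) ∂μ ≤ ENNReal.ofReal (1 / (1 - t)) := by
    -- Expanding the exponential, the factorials cancel against the moment bounds and a geometric
    -- series in `t` remains.
    have h1 : ∀ x, ENNReal.ofReal (Real.exp (s * N x))
        = ∑' k : ℕ, ENNReal.ofReal (s ^ k / k.factorial * (N x : ℝ) ^ k) := by
      intro x
      have hsum := NormedSpace.expSeries_div_hasSum_exp (s * (N x : ℝ))
      rw [← Real.exp_eq_exp_ℝ] at hsum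
      rw [← hsum.tsum_eq, ENNReal.ofReal_tsum_of_nonneg (fun k => by positivity) hsum.summable]
      exact tsum_congr fun k => by congr 1; rw [mul_pow]; ring
    simp_rw [h1]
    rw [lintegral_tsum fun k => ((hNm.pow_const k).const_mul _).ennreal_ofReal]
    have hgeom := hasSum_geometric_of_lt_one ht0 ht
    rw [one_div, ← hgeom.tsum_eq, ENNReal.ofReal_tsum_of_nonneg (fun k => by positivity)
      hgeom.summable]
    refine ENNReal.tsum_le_tsum fun k => ?_
    rw [← ofReal_integral_eq_lintegral_ofReal ((h k).1.const_mul _)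
      (Eventually.of_forall fun x => by positivity), integral_const_mul]
    refine ENNReal.ofReal_le_ofReal ?_
    calc s ^ k / k.factorial * ∫ x, (N x : ℝ) ^ k ∂μ
        ≤ s ^ k / k.factorial * (k.factorial * a ^ k) :=
          mul_le_mul_of_nonneg_left (h k).2 (by positivity)
      _ = (s * a) ^ k := by
          have : (k.factorial : ℝ) ≠ 0 := by positivity
          rw [mul_pow]; field_simp
      _ ≤ t ^ k := pow_le_pow_left₀ h0 hst k
  have hint : Integrable (fun x => Real.exp (s * N x)) μ := by
    refine ⟨hm, ?_⟩
    rw [hasFiniteIntegral_iff_ofReal (Eventually.of_forall fun x => (Real.exp_pos _).le)]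
    exact hle.trans_lt ENNReal.ofReal_lt_top
  refine ⟨hint, ?_⟩
  rw [← ENNReal.ofReal_le_ofReal_iff (by rw [one_div]; exact inv_nonneg.2 (by linarith)),
    ofReal_integral_eq_lintegral_ofReal hint (Eventually.of_forall fun x => (Real.exp_pos _).le)]
  exact hle

/-! ### Exhausting balls by finitely many edges -/

namespace WeightedMultigraph

variable {V E : Type*} {G : WeightedMultigraph V E}

/-- A family of positive conductances with finite sum is countable, so each vertex has countably
many edges. -/
lemma countable_edges [Countable V] (htop : ∀ v, G.vertexCond v ≠ ∞) : Countable E := by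
  have h1 : ∀ v, {e | v ∈ G.ends e}.Countable := by
    intro v
    have h2 := Summable.countable_support_ennreal (htop v)
    have h3 : Function.support (fun e : {e : E // v ∈ G.ends e} => (G.c e : ℝ≥0∞)) = Set.univ := by
      ext e
      simpa using (G.c_pos e).ne'
    rw [h3, Set.countable_univ_iff] at h2
    exact Set.countable_coe_iff.1 h2
  rw [← Set.countable_univ_iff]
  refine (Set.countable_iUnion h1).mono fun e _ => ?_
  obtain ⟨v, hv⟩ : ∃ v, v ∈ G.ends e := by
    induction hp : G.ends e with
    | h a b => exact ⟨a, Sym2.mem_mk_left a b⟩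
  exact Set.mem_iUnion.2 ⟨v, hv⟩

lemma exists_monotone_finset (α : Type*) [Countable α] :
    ∃ A : ℕ → Finset α, Monotone A ∧ ∀ S : Finset α, ∃ n, S ⊆ A n := by
  obtain ⟨f, hf⟩ := exists_injective_nat α
  refine ⟨fun n => ((Set.finite_Iio n).preimage hf.injOn).toFinset, fun m n h => ?_, fun S => ?_⟩
  · intro x hx
    simp only [Set.Finite.mem_toFinset, Set.mem_preimage, Set.mem_Iio] at hx ⊢
    omega
  · refine ⟨S.sup f + 1, fun x hx => ?_⟩
    simp only [Set.Finite.mem_toFinset, Set.mem_preimage, Set.mem_Iio]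
    exact Nat.lt_succ_of_le (Finset.le_sup (f := f) hx)

lemma exists_subset_intrinsicBall_inter {A : ℕ → Finset E} (hA : Monotone A)
    (hA' : ∀ S : Finset E, ∃ n, S ⊆ A n) (ω : Set E) (v : V) (n : ℕ) (S : Finset V)
    (hS : (S : Set V) ⊆ G.intrinsicBall ω v n) :
    ∃ j, (S : Set V) ⊆ G.intrinsicBall (ω ∩ A j) v n := by
  classical
  have h1 : ∀ u : V, ∃ j, u ∈ S → u ∈ G.intrinsicBall (ω ∩ A j) v n := by
    intro u
    by_cases hu : u ∈ S
    · obtain ⟨B, hB⟩ := exists_finset_mem_intrinsicBall (hS (Finset.mem_coe.2 hu))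
      obtain ⟨j, hj⟩ := hA' B
      exact ⟨j, fun _ => intrinsicBall_mono
        (Set.inter_subset_inter_right ω (Finset.coe_subset.2 hj)) v n hB⟩
    · exact ⟨0, fun h => absurd h hu⟩
  choose j hj using h1
  refine ⟨S.sup j, fun u hu => ?_⟩
  exact intrinsicBall_mono (Set.inter_subset_inter_right ω
    (Finset.coe_subset.2 (hA (Finset.le_sup (f := j) (Finset.mem_coe.1 hu))))) v n
    (hj u (Finset.mem_coe.1 hu))

/-- The size of a ball is the limit of the sizes of the balls that use finitely many edges. -/
lemma finite_and_ncard_eq_iSup {A : ℕ → Finset E} (hA : Monotone A)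
    (hA' : ∀ S : Finset E, ∃ n, S ⊆ A n) (ω : Set E) (v : V) (n : ℕ)
    (h : ⨆ j, ((G.intrinsicBall (ω ∩ A j) v n).ncard : ℝ≥0∞) ≠ ∞) :
    (G.intrinsicBall ω v n).Finite ∧ ((G.intrinsicBall ω v n).ncard : ℝ≥0∞)
      = ⨆ j, ((G.intrinsicBall (ω ∩ A j) v n).ncard : ℝ≥0∞) := by
  have hle : ∀ S : Finset V, (S : Set V) ⊆ G.intrinsicBall ω v n →
      (S.card : ℝ≥0∞) ≤ ⨆ j, ((G.intrinsicBall (ω ∩ A j) v n).ncard : ℝ≥0∞) := by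
    intro S hS
    obtain ⟨j, hj⟩ := exists_subset_intrinsicBall_inter hA hA' ω v n S hS
    refine le_trans ?_ (le_iSup _ j)
    rw [← Set.ncard_coe_finset, Nat.cast_le]
    exact Set.ncard_le_ncard hj (finite_intrinsicBall_inter ω (A j) v n)
  -- Finiteness must come first: `ncard` of an infinite set is 0, and the claimed equality could
  -- then fail.
  have hfin : (G.intrinsicBall ω v n).Finite := by
    by_contra hinf
    obtain ⟨N, hN⟩ := ENNReal.exists_nat_gt h
    obtain ⟨S, hS, hcard⟩ := Set.Infinite.exists_subset_card_eq hinf N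
    have := hle S hS
    rw [hcard] at this
    exact absurd this hN.not_ge
  refine ⟨hfin, le_antisymm ?_ (iSup_le fun j => ?_)⟩
  · have := hle hfin.toFinset (by simp)
    rwa [← Set.ncard_eq_toFinset_card _ hfin] at this
  · exact Nat.cast_le.2 (Set.ncard_le_ncard (intrinsicBall_mono Set.inter_subset_left v n) hfin)

end WeightedMultigraph
end

theorem proposition5p1 {V E Ω : Type*} (G : WeightedMultigraph V E) (hG : G.IsNetwork)
    (hc : G.ControlledStationaryMeasure) (hb : G.bubbleNorm ≠ ∞)
    [MeasurableSpace Ω] (μ : Measure Ω) [IsProbabilityMeasure μ]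
    (F : Ω → Set E) (hF : G.IsWUSF μ F) (v : V) (n : ℕ) :
    (∀ᵐ ω ∂μ, (G.intrinsicBall (F ω) v n).Finite) ∧
    (∀ k : ℕ, 1 ≤ k →
      Integrable (fun ω => ((G.intrinsicBall (F ω) v n).ncard : ℝ) ^ k) μ ∧
      ∫ ω, ((G.intrinsicBall (F ω) v n).ncard : ℝ) ^ k ∂μ
        ≤ Real.exp 1 * k * (k.factorial : ℝ) * G.alpha ^ k * ((n : ℝ) + 1) ^ (2 * k)) ∧
    (∀ t : ℝ, 0 ≤ t → t < 1 →
      Integrable (fun ω => Real.exp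
        (t / (G.alpha * ((n : ℝ) + 1) ^ 2) * ((G.intrinsicBall (F ω) v n).ncard : ℝ))) μ ∧
      ∫ ω, Real.exp
        (t / (G.alpha * ((n : ℝ) + 1) ^ 2) * ((G.intrinsicBall (F ω) v n).ncard : ℝ)) ∂μ
        ≤ 1 / (1 - t)) := by
  have htop := hG.vertexCond_ne_top
  obtain ⟨C, hC, hcC⟩ := hc
  have hCinv : (((C⁻¹ : ℝ≥0) : ℝ≥0∞)) ≠ 0 := by simpa using hC.ne'
  have h0 : ∀ v, G.vertexCond v ≠ 0 := fun v h => hCinv (le_zero_iff.1 (h ▸ (hcC v).1))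
  have hsup : ⨆ u, G.vertexCond u ≠ ∞ :=
    ne_top_of_le_ne_top ENNReal.coe_ne_top (iSup_le fun u => (hcC u).2)
  have hinf0 : ⨅ u, G.vertexCond u ≠ 0 := fun h =>
    hCinv (le_zero_iff.1 (h ▸ le_iInf fun u => (hcC u).1))
  have hinftop : ⨅ u, G.vertexCond u ≠ ∞ := ne_top_of_le_ne_top (htop v) (iInf_le _ v)
  set m : ℝ := (⨅ u, G.vertexCond u).toReal with hm
  set M : ℝ := (⨆ u, G.vertexCond u).toReal with hM
  have hm0 : 0 < m := ENNReal.toReal_pos hinf0 hinftop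
  have hM0 : 0 ≤ M := ENNReal.toReal_nonneg
  have hmc : ∀ x, m ≤ (G.vertexCond x).toReal := fun x =>
    ENNReal.toReal_mono (htop x) (iInf_le _ x)
  have hcM : ∀ x, (G.vertexCond x).toReal ≤ M := fun x =>
    ENNReal.toReal_mono hsup (le_iSup G.vertexCond x)
  have halpha : G.alpha = 4 * (M / m * G.bubbleNorm.toReal) := by
    rw [WeightedMultigraph.alpha, ENNReal.toReal_mul, ENNReal.toReal_div]
  have hβ : 0 ≤ M / m * G.bubbleNorm.toReal := by positivity
  set a : ℝ := M / m * G.bubbleNorm.toReal * (n + 1) ^ 2 with ha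
  have ha0 : 0 ≤ a := by positivity
  -- An exhaustion by finite sets forces countability; the edges can then be exhausted by a
  -- sequence, as monotone convergence requires.
  have hcountV : Countable V := by
    obtain ⟨-, W, hW, -⟩ := hF
    rw [← Set.countable_univ_iff]
    refine (Set.countable_iUnion fun j => (W j).countable_toSet).mono fun x _ => ?_
    obtain ⟨j, hj⟩ := hW.2 x
    exact Set.mem_iUnion.2 ⟨j, hj⟩
  have hcountE : Countable E := WeightedMultigraph.countable_edges htop
  obtain ⟨A, hA, hA'⟩ := WeightedMultigraph.exists_monotone_finset E
  set Y : ℕ → Ω → ℝ≥0∞ := fun j x => ((G.intrinsicBall (F x ∩ A j) v n).ncard : ℝ≥0∞) with hY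
  have hYm : ∀ j, Measurable (Y j) := fun j =>
    (measurable_inter_finset (A j) fun ω => ((G.intrinsicBall ω v n).ncard : ℝ≥0∞)).comp hF.1
  have hYmono : Monotone Y := fun i j hij x => Nat.cast_le.2 (Set.ncard_le_ncard
    (WeightedMultigraph.intrinsicBall_mono (Set.inter_subset_inter_right _
      (Finset.coe_subset.2 (hA hij))) v n)
    (WeightedMultigraph.finite_intrinsicBall_inter _ _ v n))
  set L : Ω → ℝ≥0∞ := fun x => ⨆ j, Y j x with hL
  have hLm : Measurable L := Measurable.iSup hYm
  have hLk : ∀ k : ℕ, ∫⁻ x, L x ^ k ∂μ ≤ ENNReal.ofReal (k.factorial * a ^ k) := by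
    intro k
    -- Powers commute with the increasing supremum by continuity, since both sides are limits of the
    -- same sequence.
    have h1 : ∀ x, L x ^ k = ⨆ j, Y j x ^ k := fun x =>
      tendsto_nhds_unique ((ENNReal.continuous_pow k).continuousAt.tendsto.comp
        (tendsto_atTop_iSup fun i j hij => hYmono hij x))
        (tendsto_atTop_iSup fun i j hij => pow_le_pow_left' (hYmono hij x) k)
    simp_rw [h1]
    rw [lintegral_iSup (fun j => (hYm j).pow_const k)
      fun i j hij x => pow_le_pow_left' (hYmono hij x) k]
    exact iSup_le fun j =>
      WeightedMultigraph.lintegral_ncard_inter_pow_le h0 htop hb hm0 hmc hcM hF v n k (A j)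
  have hLfin : ∀ᵐ x ∂μ, L x ≠ ∞ := by
    have h1 := hLk 1
    simp only [pow_one] at h1
    filter_upwards [ae_lt_top hLm (ne_top_of_le_ne_top ENNReal.ofReal_ne_top h1)] with x hx
    exact hx.ne
  have hball : ∀ᵐ x ∂μ, (G.intrinsicBall (F x) v n).Finite ∧
      ((G.intrinsicBall (F x) v n).ncard : ℝ≥0∞) = L x := by
    filter_upwards [hLfin] with x hx
    exact WeightedMultigraph.finite_and_ncard_eq_iSup hA hA' (F x) v n hx
  have hmom : ∀ k : ℕ, Integrable (fun ω => ((G.intrinsicBall (F ω) v n).ncard : ℝ) ^ k) μ ∧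
      ∫ ω, ((G.intrinsicBall (F ω) v n).ncard : ℝ) ^ k ∂μ ≤ k.factorial * a ^ k := fun k =>
    integrable_pow_and_integral_le hLm (hball.mono fun x hx => hx.2) (by positivity) (hLk k)
  refine ⟨hball.mono fun x hx => hx.1, fun k hk => ⟨(hmom k).1, (hmom k).2.trans ?_⟩,
    fun t ht0 ht1 => ?_⟩
  · have hα : a ≤ G.alpha * (n + 1) ^ 2 := by
      rw [halpha, ha]
      exact mul_le_mul_of_nonneg_right (by linarith) (by positivity)
    -- The factor `e k` and the 4 in `α` are slack: `k! a^k` is already smaller.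
    have hek : 1 ≤ Real.exp 1 * k := one_le_mul_of_one_le_of_one_le
      (Real.one_le_exp zero_le_one) (by exact_mod_cast hk)
    calc (k.factorial : ℝ) * a ^ k ≤ k.factorial * (G.alpha * (n + 1) ^ 2) ^ k :=
          mul_le_mul_of_nonneg_left (pow_le_pow_left₀ ha0 hα k) (by positivity)
      _ ≤ Real.exp 1 * k * (k.factorial * (G.alpha * (n + 1) ^ 2) ^ k) :=
          le_mul_of_one_le_left (mul_nonneg (by positivity) (pow_nonneg (ha0.trans hα) k)) hek
      _ = _ := by rw [mul_pow, ← pow_mul]; ring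
  · have hα0 : 0 ≤ G.alpha * ((n : ℝ) + 1) ^ 2 := by rw [halpha]; positivity
    refine integrable_exp_and_integral_le ?_ ha0 (div_nonneg ht0 hα0) ?_ ht1 hmom
    · have := (hmom 1).1.aestronglyMeasurable.aemeasurable
      simpa only [pow_one] using this
    · have haα : a ≤ G.alpha * (n + 1) ^ 2 := by
        rw [halpha, ha]
        exact mul_le_mul_of_nonneg_right (by linarith) (by positivity)
      calc t / (G.alpha * ((n : ℝ) + 1) ^ 2) * a
          ≤ t / (G.alpha * ((n : ℝ) + 1) ^ 2) * (G.alpha * ((n : ℝ) + 1) ^ 2) :=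
            mul_le_mul_of_nonneg_left haα (div_nonneg ht0 hα0)
        _ ≤ t := by
          -- With a zero denominator the quotient is 0 by convention, and `0 ≤ t` suffices.
          rcases hα0.eq_or_lt with h | h
          · rw [← h]; simpa using ht0
          · rw [div_mul_cancel₀ _ h.ne']
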